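/- Let $(y_{m,n})_{n\in\mathbb Z}$, $m\ge 1$, be mutually independent zero-mean stationary complex Gaussian time series on a probability space; that is, for each $m$, $\mathbb E[y_{m,n}]=0$, $r_{m,u}:=\mathbb E[y_{m,n+u}\overline{y_{m,n}}]$ does not depend on $n$, and every finite complex linear combination $x$ of $(y_{m,n})_{n\in\mathbb Z}$ is $\mathcal N_{\mathbb C}(0,\sigma^2)$ for some $\sigma^2\ge0$ ($\mathrm{Re}\,x$ and $\mathrm{Im}\,x$ are independent and $\mathcal N(0,\sigma^2/2)$). Let $s_m(\nu)=\sum_{u\in\mathbb Z} r_{m,u}e^{-2i\pi u\nu}$ be the spectral densities, and assume that $$\inf_{m\ge1}\inf_{\nu\in[0,1]}|s_m(\nu)|>0,\qquad \sup_{m\ge1}\sum_{u\in\mathbb Z}(1+|u|)^{\gamma_0}|r_{m,u}|<\infty\quad\text{for some }\gamma_0\ge3 .$$ Let $M=M(N)$ and $B=B(N)$ be nonnegative integers, $B$ even, such that $B,M=\mathcal O(N^\alpha)$ for some $\alpha\in(1/2,1)$, $N^{\delta}=\mathcal O(B)$ for some $\delta>0$, and $\frac{M}{B+1}\to c\in(0,1)$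 as $N\to\infty$. (In particular, $B$ and $M$ may be of exact order $N^\alpha$.) Put $\boldsymbol\xi(\nu)=\big(\xi_1(\nu),\dots,\xi_M(\nu)\big)^T$ with $\xi_m(\nu)=\frac1{\sqrt N}\sum_{n=1}^N y_{m,n}e^{-2i\pi(n-1)\nu}$, and $$\hat{S}_N(\nu)=\frac1{B+1}\sum_{b=-B/2}^{B/2}\boldsymbol\xi\big(\nu+\tfrac bN\big)\boldsymbol\xi\big(\nu+\tfrac bN\big)^*,\qquad \hat C_N(\nu)=\mathrm{diag}(\hat S_N(\nu))^{-1/2}\,\hat S_N(\nu)\,\mathrm{diag}(\hat S_N(\nu))^{-1/2},$$ $$\tilde C_N(\nu)=\mathrm{diag}(s_1(\nu),\dots,s_M(\nu))^{-1/2}\,\hat S_N(\nu)\,\mathrm{diag}(s_1(\nu),\dots,s_M(\nu))^{-1/2},$$ where $\mathrm{diag}(\hat S_N(\nu))$ is the diagonal part of $\hat S_N(\nu)$. Then, for every $\epsilon>0$, the two families of events, indexed by $N\ge1$ and $\nu\in[0,1]$, that all eigenvalues of $\tilde C_N(\nu)$ (respectively of $\hat C_N(\nu)$) lie in $[(1-\sqrt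 c)^2-\epsilon,(1+\sqrt c)^2+\epsilon]$ hold with exponentially high probability. That is, for each of the two families $\Lambda_N(\nu)$ there exist $N_0$ and $\gamma>0$, independent of $\nu$ and $N$, such that $\mathbb P[\Lambda_N(\nu)]>1-\exp(-N^\gamma)$ for all $N\ge N_0$ and all $\nu\in[0,1]$. -/

import Mathlib

open MeasureTheory ProbabilityTheory Filter Topology Asymptotics
open scoped ENNReal NNReal

noncomputable section

namespace Coherency

variable {Ω : Type*} [MeasurableSpace Ω]

/-- The complex random variable `x` is `N_ℂ(0, v)` distributed: its real and imaginary parts are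
independent and both `N(0, v / 2)` distributed. -/
def IsComplexGaussian (P : Measure Ω) (x : Ω → ℂ) (v : ℝ≥0) : Prop :=
  P.map (fun ω => (x ω).re) = gaussianReal 0 (v / 2) ∧
  P.map (fun ω => (x ω).im) = gaussianReal 0 (v / 2) ∧
  IndepFun (fun ω => (x ω).re) (fun ω => (x ω).im) P

/-- Zero mean stationary complex Gaussian time series `(y n)_{n ∈ ℤ}`: every finite complex linear
combination of the `y n` is complex Gaussian, and `E[y (n + u) * conj (y n)]` does not depend
on `n`. -/
structure IsStationaryGaussianSeries (P : Measure Ω) (y : ℤ → Ω → ℂ) : Prop where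
  measurable : ∀ n, Measurable (y n)
  mean_zero : ∀ n, ∫ ω, y n ω ∂P = 0
  gaussian : ∀ (T : Finset ℤ) (a : ℤ → ℂ),
    ∃ v : ℝ≥0, IsComplexGaussian P (fun ω => ∑ n ∈ T, a n * y n ω) v
  stationary : ∀ n u : ℤ,
    ∫ ω, y (n + u) ω * star (y n ω) ∂P = ∫ ω, y u ω * star (y 0 ω) ∂P

/-- The autocovariance sequence `r_u = E[y_{n+u} * conj y_n]` of a stationary series
(computed at `n = 0`). -/
def autocov (P : Measure Ω) (y : ℤ → Ω → ℂ) (u : ℤ) : ℂ :=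
  ∫ ω, y u ω * star (y 0 ω) ∂P

/-- The spectral density `s(ν) = ∑_{u ∈ ℤ} r_u e^{-2iπuν}`. The sum is real because
`r_{-u} = conj r_u`, so that taking the real part only changes its type. -/
def spectralDensity (P : Measure Ω) (y : ℤ → Ω → ℂ) (ν : ℝ) : ℝ :=
  (∑' u : ℤ, autocov P y u * Complex.exp (-2 * Complex.I * Real.pi * u * ν)).re

/-- The spectral densities are bounded away from zero, and the autocovariance sequences satisfy
`sup_m ∑_u (1 + |u|)^γ₀ |r_{m,u}| < ∞`. (Extended nonnegative sums, suprema and infima, so no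
convention for divergent sums is involved.) -/
structure SpectralRegularity (P : Measure Ω) (y : ℕ → ℤ → Ω → ℂ) (γ₀ : ℝ) : Prop where
  inf_pos : 0 < ⨅ m : ℕ, ⨅ ν ∈ Set.Icc (0 : ℝ) 1, ‖spectralDensity P (y m) ν‖ₑ
  sup_finite :
    ⨆ m : ℕ, ∑' u : ℤ, ENNReal.ofReal ((1 + |(u : ℝ)|) ^ γ₀) * ‖autocov P (y m) u‖ₑ < ∞

/-- The asymptotic regime: `B` is even, `B, M = O(N^α)` with `1/2 < α < 1`, `B` grows at least like
some positive power of `N`, and `M / (B + 1) → c ∈ (0, 1)`. -/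
structure GrowthRegime (B M : ℕ → ℕ) (α c : ℝ) : Prop where
  even_B : ∀ N, Even (B N)
  half_lt : 1 / 2 < α
  lt_one : α < 1
  B_isBigO : (fun N : ℕ => (B N : ℝ)) =O[atTop] (fun N : ℕ => (N : ℝ) ^ α)
  M_isBigO : (fun N : ℕ => (M N : ℝ)) =O[atTop] (fun N : ℕ => (N : ℝ) ^ α)
  B_growth : ∃ δ : ℝ, 0 < δ ∧ (fun N : ℕ => (N : ℝ) ^ δ) =O[atTop] (fun N : ℕ => (B N : ℝ))
  c_pos : 0 < c
  c_lt_one : c < 1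
  ratio_tendsto : Tendsto (fun N : ℕ => (M N : ℝ) / ((B N : ℝ) + 1)) atTop (𝓝 c)

/-- The normalised Fourier transform `N^{-1/2} ∑_{n=1}^N y_n e^{-2iπ(n-1)ν}` of the samples. -/
def fourierCoeff (y : ℤ → Ω → ℂ) (N : ℕ) (ν : ℝ) (ω : Ω) : ℂ :=
  (1 / (Real.sqrt N : ℂ)) * ∑ n ∈ Finset.Icc 1 N,
    y (n : ℤ) ω * Complex.exp (-2 * Complex.I * Real.pi * ((n : ℂ) - 1) * ν)

/-- The frequency smoothed periodogram, an `M × M` matrix, for the first `M` series (indexed from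
`0`) and the smoothing span `B`:
`(B + 1)⁻¹ ∑_{b=-B/2}^{B/2} ξ(ν + b/N) ξ(ν + b/N)^*`. -/
def smoothedPeriodogram (y : ℕ → ℤ → Ω → ℂ) (N B M : ℕ) (ν : ℝ) (ω : Ω) :
    Matrix (Fin M) (Fin M) ℂ :=
  (1 / ((B : ℂ) + 1)) • ∑ b ∈ Finset.Icc (-((B / 2 : ℕ) : ℤ)) ((B / 2 : ℕ) : ℤ),
    Matrix.vecMulVec
      (fun m : Fin M => fourierCoeff (y m) N (ν + (b : ℝ) / N) ω)
      (star fun m : Fin M => fourierCoeff (y m) N (ν + (b : ℝ) / N) ω)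

/-- `diag(d)^{-1/2} * A * diag(d)^{-1/2}` for a real vector `d` (with positive entries). -/
def normalizeBy {M : ℕ} (d : Fin M → ℝ) (A : Matrix (Fin M) (Fin M) ℂ) :
    Matrix (Fin M) (Fin M) ℂ :=
  Matrix.diagonal (fun m => (((Real.sqrt (d m))⁻¹ : ℝ) : ℂ)) * A *
    Matrix.diagonal (fun m => (((Real.sqrt (d m))⁻¹ : ℝ) : ℂ))

/-- The estimated spectral coherency matrix `diag(Ŝ)^{-1/2} Ŝ diag(Ŝ)^{-1/2}`
(the diagonal entries of `Ŝ` are real and nonnegative). -/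
def hatC (y : ℕ → ℤ → Ω → ℂ) (N B M : ℕ) (ν : ℝ) (ω : Ω) : Matrix (Fin M) (Fin M) ℂ :=
  normalizeBy (fun m => (smoothedPeriodogram y N B M ν ω m m).re)
    (smoothedPeriodogram y N B M ν ω)

/-- The matrix `diag(S)^{-1/2} Ŝ diag(S)^{-1/2}` with `S = diag(s_1(ν), …, s_M(ν))`. -/
def tildeC (P : Measure Ω) (y : ℕ → ℤ → Ω → ℂ) (N B M : ℕ) (ν : ℝ) (ω : Ω) :
    Matrix (Fin M) (Fin M) ℂ :=
  normalizeBy (fun m => spectralDensity P (y m) ν) (smoothedPeriodogram y N B M ν ω)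

/-- All (complex) eigenvalues of `A` are real and lie in the `ε`-enlargement
`[(1 - √c)² - ε, (1 + √c)² + ε]` of the support of the Marchenko–Pastur distribution. -/
def SpectrumLocalized {M : ℕ} (A : Matrix (Fin M) (Fin M) ℂ) (c ε : ℝ) : Prop :=
  spectrum ℂ A ⊆ Complex.ofReal ''
    Set.Icc ((1 - Real.sqrt c) ^ 2 - ε) ((1 + Real.sqrt c) ^ 2 + ε)

/-- A family of events `Ξ N u`, `u ∈ U N`, holds with exponentially high probability: there are
`N₀` and `γ > 0`, independent of `u`, with `P (Ξ N u) > 1 - exp (-N^γ)` for all `N ≥ N₀` and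
all `u`. -/
def HoldsWithExpHighProb (P : Measure Ω) {U : ℕ → Type*} (Ξ : (N : ℕ) → U N → Set Ω) : Prop :=
  ∃ (N₀ : ℕ) (γ : ℝ), 0 < γ ∧ ∀ N : ℕ, N₀ ≤ N → ∀ u : U N,
    1 - Real.exp (-((N : ℝ) ^ γ)) < P.real (Ξ N u)

end Coherency

end

/-!
Both estimators are Gram matrices. Let `X` be the `M × (B + 1)` matrix of the Fourier coefficients
at the smoothing frequencies, its row `m` divided by `√s_m(ν)`. Then `C̃ = (B + 1)⁻¹ X X^*`, and
`Ĉ` is obtained in the same way from `X` after its rows have been rescaled to length `√(B + 1)`.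
It therefore suffices that `X` is typical (`typicalMat`) outside an event of probability
`exp (-N ^ γ)`: the singular values of `X` are close to `[(1 - √c) √(B + 1), (1 + √c) √(B + 1)]`
and its rows have lengths close to `√(B + 1)` (`spectrumLocalized_of_typical`). All constants are
uniform in `ν`.

*Reduction to independent entries.* The rows of `X` are independent. Within a row, the
coefficients `ξ_m(ν + b / N)` have covariances `s_m(ν + b / N) δ_{b b'} + O(1 / N)`, because the
autocovariances have a finite first moment and the characters of the grid `ℤ / N` are orthogonal
(`norm_covariance_sub_le`). After division of each coefficient by the square root of its own
density the covariance matrix of a row is at Frobenius distance `O(B / N)` from the identity, and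
multiplying the row by the inverse square root of this matrix gives an exactly standard Gaussian
vector (`IsGaussianFamily.exists_whitening`). The whitening changes the matrix, in Frobenius norm,
by `√M · √r · O(B / N)` with probability `1 - O(M B exp (-r / 2))`. Since `B = O(N ^ α)` with
`α < 1`, the choice `r = N ^ (1 - α)` makes this `o(√B)`.

*Freezing the frequency.* Passing from the densities at `ν + b / N` to the one at `ν` multiplies
the matrix entrywise by weights which are within `O(B / N)` of `1` and whose increments along a
row are `O(1 / N)`. An entrywise product with small weights need not be small in operator norm,
but summation by parts along the rows expresses this one through products with diagonal matrices
and coordinate projections, with a total cost of `O(B / N)` (`norm_act_hadamard_sub_le`).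

*Gaussian matrices.* For an `m × n` standard complex Gaussian matrix `G`, the edges `(√n ± √m)²`
of the spectrum of `G G^*` come from Silverstein's bidiagonalisation. A unitary change of
coordinates on the right turns the first row into a multiple of the first basis vector; one on the
left, on the other rows, does so for the rest of the first column; what remains is an independent
`(m - 1) × (n - 1)` Gaussian matrix. The tridiagonal matrix obtained in the end is built
from chi variables, which concentrate, and Gershgorin's theorem gives its edges. The proof performs this as
an induction on the failure probability of an inequality between quadratic forms, with an extra
weight on the first coordinate that records the row split off before (`formBounded`,
`cgaussMat_formBounded_step`). By Fubini's theorem the change of coordinates is used only for a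
fixed row and column, so that no measurable choice of it is necessary. The result is
`cgaussMat_formBounded`, which yields `cgaussMat_typical`.
-/

namespace Coherency

/-! ### Complex Gaussian variables and vectors -/

/-- The characteristic function of `N_ℂ(0, v)`. -/
theorem IsComplexGaussian.charFun_map {Ω : Type*} [MeasurableSpace Ω] {P : Measure Ω}
    [IsProbabilityMeasure P] {x : Ω → ℂ} {v : ℝ≥0} (h : IsComplexGaussian P x v)
    (hx : Measurable x) (t : ℂ) :
    charFun (P.map x) t = Complex.exp (-(v * ‖t‖ ^ 2 / 4)) := by
  obtain ⟨h1, h2, h3⟩ := h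
  have hre : Measurable fun ω => (x ω).re := Complex.measurable_re.comp hx
  have him : Measurable fun ω => (x ω).im := Complex.measurable_im.comp hx
  rw [charFun_apply, integral_map hx.aemeasurable (by fun_prop)]
  have e1 : ∀ ω, Complex.exp ((inner ℝ (x ω) t : ℝ) * Complex.I) =
      Complex.exp (((x ω).re * t.re : ℝ) * Complex.I) *
        Complex.exp (((x ω).im * t.im : ℝ) * Complex.I) := by
    intro ω
    rw [← Complex.exp_add, ← add_mul, ← Complex.ofReal_add, Complex.inner]
    congr 3
    simp
    ring
  simp_rw [e1]
  have h4 := IndepFun.integral_fun_comp_mul_comp (μ := P) (𝕜 := ℂ)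
    (f := fun u : ℝ => Complex.exp ((u * t.re : ℝ) * Complex.I))
    (g := fun u : ℝ => Complex.exp ((u * t.im : ℝ) * Complex.I)) h3 hre.aemeasurable
    him.aemeasurable (by fun_prop) (by fun_prop)
  rw [h4]
  have e2 : ∀ (f : Ω → ℝ) (s : ℝ), Measurable f → P.map f = gaussianReal 0 (v / 2) →
      ∫ ω, Complex.exp ((f ω * s : ℝ) * Complex.I) ∂P = Complex.exp (-(v * s ^ 2 / 4)) := by
    intro f s hf hm
    have := charFun_gaussianReal (μ := 0) (v := v / 2) s
    rw [← hm, charFun_apply, integral_map hf.aemeasurable (by fun_prop)] at this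
    rw [show (fun ω => Complex.exp ((f ω * s : ℝ) * Complex.I)) =
      fun ω => Complex.exp ((inner ℝ (f ω) s : ℝ) * Complex.I) by
        ext ω; simp [mul_comm], this]
    congr 1
    push_cast
    ring
  rw [e2 _ _ hre h1, e2 _ _ him h2, ← Complex.exp_add]
  congr 1
  rw [← Complex.ofReal_pow ‖t‖, Complex.sq_norm, Complex.normSq_apply]
  push_cast
  ring

/-- The standard complex Gaussian law `N_ℂ(0, 1)` on `ℂ`. -/
noncomputable def cgauss : Measure ℂ :=
  ((gaussianReal 0 (1 / 2)).prod (gaussianReal 0 (1 / 2))).map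
    Complex.measurableEquivRealProd.symm

instance : IsProbabilityMeasure cgauss :=
  Measure.isProbabilityMeasure_map Complex.measurableEquivRealProd.symm.measurable.aemeasurable

theorem isComplexGaussian_cgauss : IsComplexGaussian cgauss (fun z => z) 1 := by
  have hm : Measurable Complex.measurableEquivRealProd.symm :=
    Complex.measurableEquivRealProd.symm.measurable
  have h1 : cgauss.map (fun z : ℂ => z.re) = gaussianReal 0 (1 / 2) := by
    rw [cgauss, Measure.map_map Complex.measurable_re hm]
    exact measurePreserving_fst.map_eq
  have h2 : cgauss.map (fun z : ℂ => z.im) = gaussianReal 0 (1 / 2) := by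
    rw [cgauss, Measure.map_map Complex.measurable_im hm]
    exact measurePreserving_snd.map_eq
  refine ⟨h1, h2, ?_⟩
  rw [indepFun_iff_map_prod_eq_prod_map_map Complex.measurable_re.aemeasurable
    Complex.measurable_im.aemeasurable, h1, h2]
  change cgauss.map Complex.measurableEquivRealProd = _
  rw [cgauss, Measure.map_map Complex.measurableEquivRealProd.measurable hm]
  simp

theorem charFun_cgauss (t : ℂ) : charFun cgauss t = Complex.exp (-(‖t‖ ^ 2 / 4)) := by
  have := isComplexGaussian_cgauss.charFun_map measurable_id' t
  simpa using this

/-- The law of a vector of `|ι|` independent standard complex Gaussian variables. -/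
noncomputable def cgaussVec (ι : Type*) [Fintype ι] : Measure (ι → ℂ) :=
  Measure.pi fun _ => cgauss

instance (ι : Type*) [Fintype ι] : IsProbabilityMeasure (cgaussVec ι) := by
  unfold cgaussVec; infer_instance

theorem measurable_linForm {ι : Type*} [Fintype ι] (a : ι → ℂ) :
    Measurable fun z : ι → ℂ => ∑ i, a i * z i := by
  fun_prop

/-- A probability measure on `ℂ^ι` is the standard complex Gaussian law as soon as the real part
of every linear form has the characteristic function (at `1`) of a standard Gaussian. -/
theorem eq_cgaussVec {ι : Type*} [Fintype ι] {μ : Measure (ι → ℂ)} [IsProbabilityMeasure μ]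
    (h : ∀ a : ι → ℂ, charFun (μ.map fun z => ∑ i, a i * z i) 1 =
      Complex.exp (-((∑ i, ‖a i‖ ^ 2 : ℝ) / 4))) : μ = cgaussVec ι := by
  unfold cgaussVec
  rw [← charFun_eq_pi_iff]
  intro t
  simp_rw [charFun_cgauss, ← Complex.exp_sum]
  have h1 := h (fun i => star (t i))
  rw [charFun_apply, integral_map (measurable_linForm _).aemeasurable (by fun_prop)] at h1
  rw [charFun_apply, integral_map (by fun_prop) (by fun_prop)]
  have e : ∀ z : ι → ℂ, inner ℝ (WithLp.toLp 2 z) t =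
      inner ℝ (∑ i, star (t i) * z i) (1 : ℂ) := by
    intro z
    rw [PiLp.inner_apply, sum_inner]
    refine Finset.sum_congr rfl fun i _ => ?_
    simp [Complex.inner]
  simp_rw [e, h1]
  simp [Finset.sum_div]

/-- Orthogonal changes of coordinates preserve the standard complex Gaussian law. -/
theorem measurePreserving_cgaussVec {ι : Type*} [Fintype ι]
    (b : OrthonormalBasis ι ℂ (EuclideanSpace ℂ ι)) :
    MeasurePreserving (fun (z : ι → ℂ) (i : ι) => ∑ k, z k * b k i) (cgaussVec ι)
      (cgaussVec ι) := by
  have hm : Measurable (fun (z : ι → ℂ) (i : ι) => ∑ k, z k * b k i) := by fun_prop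
  refine ⟨hm, ?_⟩
  have : IsProbabilityMeasure ((cgaussVec ι).map (fun (z : ι → ℂ) (i : ι) => ∑ k, z k * b k i)) :=
    Measure.isProbabilityMeasure_map hm.aemeasurable
  have key : ∀ a : ι → ℂ, charFun ((cgaussVec ι).map fun z => ∑ i, a i * z i) 1 =
      Complex.exp (-((∑ i, ‖a i‖ ^ 2 : ℝ) / 4)) := by
    intro a
    have h1 := charFun_pi (μ := fun _ : ι => cgauss) (WithLp.toLp 2 fun i => star (a i))
    simp_rw [charFun_cgauss, ← Complex.exp_sum] at h1
    rw [charFun_apply, integral_map (by fun_prop) (by fun_prop)] at h1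
    rw [charFun_apply, integral_map (measurable_linForm _).aemeasurable (by fun_prop)]
    have e : ∀ z : ι → ℂ, inner ℝ (WithLp.toLp 2 z)
        ((WithLp.toLp 2 fun i => star (a i)) : EuclideanSpace ℂ ι) =
        inner ℝ (∑ i, a i * z i) (1 : ℂ) := by
      intro z
      rw [PiLp.inner_apply, sum_inner]
      refine Finset.sum_congr rfl fun i _ => ?_
      simp [Complex.inner]
    simp_rw [e] at h1
    unfold cgaussVec
    rw [h1]
    simp [Finset.sum_div]
  apply eq_cgaussVec
  intro a
  rw [Measure.map_map (by fun_prop) hm]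
  have e : ((fun z : ι → ℂ => ∑ i, a i * z i) ∘ fun (z : ι → ℂ) (i : ι) => ∑ k, z k * b k i) =
      fun z => ∑ k, (∑ i, a i * b k i) * z k := by
    ext z
    simp only [Function.comp, Finset.mul_sum, Finset.sum_mul]
    rw [Finset.sum_comm]
    refine Finset.sum_congr rfl fun i _ => Finset.sum_congr rfl fun k _ => by ring
  rw [e, key]
  have h2 := b.sum_sq_norm_inner_right (WithLp.toLp 2 fun i => star (a i))
  rw [EuclideanSpace.norm_sq_eq] at h2
  simp only [PiLp.inner_apply, RCLike.inner_apply] at h2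
  have h3 : ∑ k, ‖∑ i, a i * b k i‖ ^ 2 = ∑ i, ‖a i‖ ^ 2 := by
    convert h2 using 3 with k _ k _
    · rw [← norm_star, star_sum]
      simp
    · simp
  rw [h3]

/-! ### Exponential moments and tail bounds -/

theorem integral_exp_mul_sq_gaussianReal (t : ℝ) :
    ∫ x, Real.exp (t * x ^ 2) ∂(gaussianReal 0 (1 / 2)) = (Real.sqrt (1 - t))⁻¹ := by
  rw [integral_gaussianReal_eq_integral_smul (by norm_num)]
  have e : ∀ x : ℝ, gaussianPDFReal 0 (1 / 2) x • Real.exp (t * x ^ 2) =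
      (Real.sqrt Real.pi)⁻¹ * Real.exp (-(1 - t) * x ^ 2) := by
    intro x
    simp only [gaussianPDFReal, smul_eq_mul]
    rw [mul_assoc, ← Real.exp_add]
    congr 2
    · rw [show 2 * Real.pi * ((1 / 2 : ℝ≥0) : ℝ) = Real.pi by push_cast; ring]
    · norm_num
      ring
  simp_rw [e]
  rw [integral_const_mul, integral_gaussian, Real.sqrt_div Real.pi_pos.le]
  have : Real.sqrt Real.pi ≠ 0 := (Real.sqrt_pos.2 Real.pi_pos).ne'
  field_simp

theorem integral_exp_mul_sq_cgauss {t : ℝ} (ht : t < 1) :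
    ∫ z, Real.exp (t * ‖z‖ ^ 2) ∂cgauss = (1 - t)⁻¹ := by
  rw [cgauss, integral_map_equiv]
  have e : ∀ p : ℝ × ℝ, Real.exp (t * ‖Complex.measurableEquivRealProd.symm p‖ ^ 2) =
      Real.exp (t * p.1 ^ 2) * Real.exp (t * p.2 ^ 2) := by
    intro p
    rw [← Real.exp_add, Complex.sq_norm, Complex.normSq_apply]
    simp [Complex.measurableEquivRealProd]
    ring
  simp_rw [e]
  rw [integral_prod_mul (fun x => Real.exp (t * x ^ 2)) (fun x => Real.exp (t * x ^ 2)),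
    integral_exp_mul_sq_gaussianReal t, ← mul_inv, Real.mul_self_sqrt (by linarith)]

theorem integrable_exp_mul_sq_cgauss {t : ℝ} (ht : t < 1) :
    Integrable (fun z => Real.exp (t * ‖z‖ ^ 2)) cgauss := by
  apply Integrable.of_integral_ne_zero
  rw [integral_exp_mul_sq_cgauss ht]
  exact inv_ne_zero (by linarith)

theorem integral_exp_mul_sq_cgaussVec (ι : Type*) [Fintype ι] {t : ℝ} (ht : t < 1) :
    ∫ z, Real.exp (t * ∑ i, ‖z i‖ ^ 2) ∂(cgaussVec ι) = ((1 - t)⁻¹) ^ Fintype.card ι := by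
  simp_rw [Finset.mul_sum, Real.exp_sum]
  rw [cgaussVec, integral_fintype_prod_eq_prod (fun _ z => Real.exp (t * ‖z‖ ^ 2)),
    integral_exp_mul_sq_cgauss ht]
  simp

theorem integrable_exp_mul_sq_cgaussVec (ι : Type*) [Fintype ι] {t : ℝ} (ht : t < 1) :
    Integrable (fun z => Real.exp (t * ∑ i, ‖z i‖ ^ 2)) (cgaussVec ι) := by
  apply Integrable.of_integral_ne_zero
  rw [integral_exp_mul_sq_cgaussVec ι ht]
  exact pow_ne_zero _ (inv_ne_zero (by linarith))

theorem inv_one_sub_le_exp {t : ℝ} (ht : |t| ≤ 1 / 2) : (1 - t)⁻¹ ≤ Real.exp (t + t ^ 2) := by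
  obtain ⟨h1, h2⟩ := abs_le.1 ht
  rw [inv_le_iff_one_le_mul₀ (by linarith)]
  rcases le_total 0 t with h0 | h0
  · have h3 := Real.quadratic_le_exp_of_nonneg (x := t + t ^ 2) (by positivity)
    have h4 : 1 ≤ (1 + (t + t ^ 2) + (t + t ^ 2) ^ 2 / 2) * (1 - t) := by
      have h5 : 0 ≤ 1 - t - t ^ 2 - t ^ 3 := by
        have : t ^ 2 ≤ 1 / 4 := by nlinarith
        have : t ^ 3 ≤ 1 / 8 := by nlinarith
        linarith
      have h6 : (1 + (t + t ^ 2) + (t + t ^ 2) ^ 2 / 2) * (1 - t) - 1 =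
        t ^ 2 * (1 - t - t ^ 2 - t ^ 3) / 2 := by ring
      have : 0 ≤ t ^ 2 * (1 - t - t ^ 2 - t ^ 3) / 2 := by positivity
      linarith
    nlinarith
  · have h3 := Real.add_one_le_exp (t + t ^ 2)
    have h4 : 1 ≤ (t + t ^ 2 + 1) * (1 - t) := by
      have : 0 ≤ (-t) ^ 3 := pow_nonneg (by linarith) 3
      nlinarith
    nlinarith

/-- Concentration of the squared length of a standard complex Gaussian vector. -/
theorem cgaussVec_norm_sq_concentration (ι : Type*) [Fintype ι] {K s : ℝ} (hK : 0 < K)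
    (hι : (Fintype.card ι : ℝ) ≤ K) (hs : 0 ≤ s) (hsK : s ≤ K) :
    (cgaussVec ι).real {z | s ≤ |∑ i, ‖z i‖ ^ 2 - Fintype.card ι|} ≤
      2 * Real.exp (-(s ^ 2 / (4 * K))) := by
  obtain ⟨k, hk⟩ : ∃ k : ℝ, k = (Fintype.card ι : ℝ) := ⟨_, rfl⟩
  rw [← hk] at hι ⊢
  have hk0 : 0 ≤ k := hk ▸ Nat.cast_nonneg _
  have ht2 : s / (2 * K) ≤ 1 / 2 := by
    rw [div_le_iff₀ (by positivity)]
    linarith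
  have ht0 : 0 ≤ s / (2 * K) := by positivity
  -- Chernoff bound at `t = ± s / (2 K)`
  have key : ∀ t : ℝ, |t| = s / (2 * K) →
      Real.exp (-(s ^ 2 / (2 * K))) * Real.exp (-t * k) * mgf (fun z : ι → ℂ => ∑ i, ‖z i‖ ^ 2)
        (cgaussVec ι) t ≤ Real.exp (-(s ^ 2 / (4 * K))) := by
    intro t ht
    have h1 : t < 1 := lt_of_le_of_lt (le_abs_self t) (by linarith)
    rw [mgf, integral_exp_mul_sq_cgaussVec ι h1]
    have h2 : ((1 - t)⁻¹) ^ Fintype.card ι ≤ Real.exp (k * (t + t ^ 2)) := by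
      rw [hk, Real.exp_nat_mul]
      exact pow_le_pow_left₀ (inv_nonneg.2 (by linarith)) (inv_one_sub_le_exp (by linarith)) _
    calc _ ≤ Real.exp (-(s ^ 2 / (2 * K))) * Real.exp (-t * k) * Real.exp (k * (t + t ^ 2)) := by
          gcongr
      _ = Real.exp (-(s ^ 2 / (2 * K)) + k * t ^ 2) := by
          rw [← Real.exp_add, ← Real.exp_add]
          ring_nf
      _ ≤ _ := by
          apply Real.exp_le_exp.2
          have : k * t ^ 2 ≤ K * (s / (2 * K)) ^ 2 := by
            rw [← ht, sq_abs]
            gcongr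
          have e : K * (s / (2 * K)) ^ 2 = s ^ 2 / (4 * K) := by
            field_simp
            ring
          have e2 : s ^ 2 / (2 * K) = 2 * (s ^ 2 / (4 * K)) := by
            field_simp
            ring
          linarith
  have hu := measure_ge_le_exp_mul_mgf (μ := cgaussVec ι) (X := fun z : ι → ℂ => ∑ i, ‖z i‖ ^ 2)
    (t := s / (2 * K)) (k + s) ht0 (integrable_exp_mul_sq_cgaussVec ι (by linarith))
  have hl := measure_le_le_exp_mul_mgf (μ := cgaussVec ι) (X := fun z : ι → ℂ => ∑ i, ‖z i‖ ^ 2)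
    (t := -(s / (2 * K))) (k - s) (by linarith) (integrable_exp_mul_sq_cgaussVec ι (by linarith))
  have ku := key (s / (2 * K)) (abs_of_nonneg ht0)
  have kl := key (-(s / (2 * K))) (by rw [abs_neg, abs_of_nonneg ht0])
  have e1 : Real.exp (-(s / (2 * K)) * (k + s)) =
      Real.exp (-(s ^ 2 / (2 * K))) * Real.exp (-(s / (2 * K)) * k) := by
    rw [← Real.exp_add]
    congr 1
    ring
  have e2 : Real.exp (- -(s / (2 * K)) * (k - s)) =
      Real.exp (-(s ^ 2 / (2 * K))) * Real.exp (- -(s / (2 * K)) * k) := by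
    rw [← Real.exp_add]
    congr 1
    ring
  rw [e1] at hu
  rw [e2] at hl
  calc _ ≤ (cgaussVec ι).real ({z | k + s ≤ ∑ i, ‖z i‖ ^ 2} ∪ {z | ∑ i, ‖z i‖ ^ 2 ≤ k - s}) := by
        refine measureReal_mono fun z hz => ?_
        rcases le_abs.1 (show s ≤ |∑ i, ‖z i‖ ^ 2 - k| from hz) with h | h
        · left; show k + s ≤ ∑ i, ‖z i‖ ^ 2; linarith
        · right; show ∑ i, ‖z i‖ ^ 2 ≤ k - s; linarith
    _ ≤ _ := measureReal_union_le _ _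
    _ ≤ _ := by linarith

/-- A complex Gaussian variable has the law of a scaled standard one; `v = 0` is allowed. -/
theorem IsComplexGaussian.map_eq {Ω : Type*} [MeasurableSpace Ω] {P : Measure Ω}
    [IsProbabilityMeasure P] {x : Ω → ℂ} {v : ℝ≥0} (h : IsComplexGaussian P x v)
    (hx : Measurable x) : P.map x = cgauss.map fun z => (Real.sqrt v : ℂ) * z := by
  have : IsProbabilityMeasure (P.map x) := Measure.isProbabilityMeasure_map hx.aemeasurable
  have : IsProbabilityMeasure (cgauss.map fun z => (Real.sqrt v : ℂ) * z) :=
    Measure.isProbabilityMeasure_map (by fun_prop)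
  apply Measure.ext_of_charFun
  ext t
  rw [h.charFun_map hx, charFun_apply, integral_map (by fun_prop) (by fun_prop)]
  have e : ∀ z : ℂ, inner ℝ ((Real.sqrt v : ℂ) * z) t = inner ℝ z ((Real.sqrt v : ℂ) * t) := by
    intro z
    simp [Complex.inner]
    ring
  simp_rw [e]
  rw [← charFun_apply, charFun_cgauss]
  congr 2
  rw [norm_mul, Complex.norm_real, Real.norm_of_nonneg (Real.sqrt_nonneg _), Complex.ofReal_mul,
    mul_pow, ← Complex.ofReal_pow (Real.sqrt v), Real.sq_sqrt v.coe_nonneg]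


theorem memLp_two_cgauss : MemLp (fun z : ℂ => z) 2 cgauss := by
  have h := integrable_exp_mul_sq_cgauss (t := 1 / 2) (by norm_num)
  rw [memLp_two_iff_integrable_sq_norm (by fun_prop)]
  refine (h.const_mul 2).mono' (by fun_prop) (Eventually.of_forall fun z => ?_)
  have := Real.add_one_le_exp (1 / 2 * ‖z‖ ^ 2)
  rw [Real.norm_of_nonneg (by positivity)]
  linarith

theorem integral_sq_norm_cgauss : ∫ z, ‖z‖ ^ 2 ∂cgauss = 1 := by
  have hm : MemLp (fun x : ℝ => x) 2 (gaussianReal 0 (1 / 2)) := memLp_id_gaussianReal 2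
  have h1 : ∫ x, x ^ 2 ∂(gaussianReal 0 (1 / 2)) = 1 / 2 := by
    have := variance_eq_sub hm
    rw [variance_fun_id_gaussianReal, integral_id_gaussianReal] at this
    simp only [Pi.pow_apply] at this
    rw [← sub_zero (∫ x, x ^ 2 ∂_)]
    rw [zero_pow two_ne_zero] at this
    rw [← this]
    norm_num
  have h2 := hm.integrable_sq
  rw [cgauss, integral_map_equiv]
  have e : ∀ p : ℝ × ℝ, ‖Complex.measurableEquivRealProd.symm p‖ ^ 2 = p.1 ^ 2 + p.2 ^ 2 := by
    intro p
    rw [Complex.sq_norm, Complex.normSq_apply]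
    simp [Complex.measurableEquivRealProd]
    ring
  simp_rw [e]
  rw [integral_add (h2.comp_fst _) (h2.comp_snd _), integral_fun_fst (fun x : ℝ => x ^ 2),
    integral_fun_snd (fun x : ℝ => x ^ 2), h1]
  norm_num

section

variable {Ω : Type*} [MeasurableSpace Ω] {P : Measure Ω} [IsProbabilityMeasure P] {x : Ω → ℂ}
  {v : ℝ≥0}

theorem IsComplexGaussian.memLp (h : IsComplexGaussian P x v) (hx : Measurable x) :
    MemLp x 2 P := by
  have h1 : MemLp (fun z : ℂ => z) 2 (P.map x) := by
    rw [h.map_eq hx, memLp_map_measure_iff (by fun_prop) (by fun_prop)]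
    exact memLp_two_cgauss.const_mul _
  exact (memLp_map_measure_iff (by fun_prop) hx.aemeasurable).1 h1

theorem IsComplexGaussian.integral_sq_norm (h : IsComplexGaussian P x v) (hx : Measurable x) :
    ∫ ω, ‖x ω‖ ^ 2 ∂P = v := by
  have h1 : ∫ z, ‖z‖ ^ 2 ∂(P.map x) = v := by
    rw [h.map_eq hx, integral_map (by fun_prop) (by fun_prop)]
    simp_rw [norm_mul, mul_pow]
    rw [integral_const_mul, integral_sq_norm_cgauss, Complex.norm_real, Real.norm_eq_abs, sq_abs,
      Real.sq_sqrt v.coe_nonneg, mul_one]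
  rwa [integral_map hx.aemeasurable (by fun_prop)] at h1

/-- Chernoff bound for the squared modulus. The strict inequality makes it valid for `v = 0` too. -/
theorem IsComplexGaussian.tail (h : IsComplexGaussian P x v) (hx : Measurable x) (r : ℝ) :
    P.real {ω | r * v < ‖x ω‖ ^ 2} ≤ 2 * Real.exp (-(r / 2)) := by
  have h1 : P.real {ω | r * v < ‖x ω‖ ^ 2} = cgauss.real {z | r * v < v * ‖z‖ ^ 2} := by
    have hS : MeasurableSet {z : ℂ | r * v < ‖z‖ ^ 2} :=
      measurableSet_lt measurable_const (by fun_prop)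
    have e1 := map_measureReal_apply (μ := P) hx hS
    rw [h.map_eq hx, map_measureReal_apply (by fun_prop) hS] at e1
    rw [Set.preimage_ofPred_eq, Set.preimage_ofPred_eq] at e1
    rw [← e1]
    congr 1
    ext z
    simp only [Set.mem_ofPred_eq]
    rw [norm_mul, mul_pow, Complex.norm_real, Real.norm_eq_abs, sq_abs, Real.sq_sqrt v.coe_nonneg]
  have h2 := measure_ge_le_exp_mul_mgf (μ := cgauss) (X := fun z : ℂ => ‖z‖ ^ 2) (t := 1 / 2) r
    (by norm_num) (integrable_exp_mul_sq_cgauss (by norm_num))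
  rw [mgf, integral_exp_mul_sq_cgauss (by norm_num)] at h2
  rw [h1]
  calc _ ≤ cgauss.real {z | r ≤ ‖z‖ ^ 2} := by
        refine measureReal_mono fun z hz => ?_
        have hz' : r * v < v * ‖z‖ ^ 2 := hz
        show r ≤ ‖z‖ ^ 2
        by_contra hlt
        have : (v : ℝ) * ‖z‖ ^ 2 ≤ v * r := by gcongr; linarith
        linarith
    _ ≤ _ := h2
    _ = _ := by
        rw [show -(1 / 2) * r = -(r / 2) by ring]
        norm_num
        ring

end

/-! ### Gaussian matrices -/

/-- The law of an `m × n` matrix with independent standard complex Gaussian entries. -/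
noncomputable def cgaussMat (m n : ℕ) : Measure (Fin m → Fin n → ℂ) :=
  Measure.pi fun _ => cgaussVec (Fin n)

instance (m n : ℕ) : IsProbabilityMeasure (cgaussMat m n) := by
  unfold cgaussMat; infer_instance

theorem measurePreserving_transpose (m n : ℕ) :
    MeasurePreserving (fun (G : Fin m → Fin n → ℂ) j i => G i j) (cgaussMat m n)
      (cgaussMat n m) := by
  have hcurry : ∀ m n : ℕ, MeasurePreserving (MeasurableEquiv.curry (Fin m) (Fin n) ℂ)
      (cgaussVec (Fin m × Fin n)) (cgaussMat m n) := by
    intro m n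
    refine ⟨MeasurableEquiv.measurable _, ?_⟩
    have h := Measure.infinitePi_map_curry (ι := Fin m) (κ := Fin n) (X := ℂ)
      (fun _ _ => cgauss)
    rw [Measure.infinitePi_eq_pi, Measure.infinitePi_eq_pi] at h
    simp_rw [Measure.infinitePi_eq_pi] at h
    exact h
  have hswap : MeasurePreserving
      (MeasurableEquiv.piCongrLeft (fun _ : Fin n × Fin m => ℂ) (Equiv.prodComm (Fin m) (Fin n)))
      (cgaussVec (Fin m × Fin n)) (cgaussVec (Fin n × Fin m)) :=
    measurePreserving_piCongrLeft (fun _ : Fin n × Fin m => cgauss) _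
  have := (hcurry n m).comp (hswap.comp (hcurry m n).symm)
  convert this using 1
  ext G j i
  simp [MeasurableEquiv.piCongrLeft, Equiv.piCongrLeft, MeasurableEquiv.curry]

/-- Multiplication on the right by a unitary matrix preserves the law of a Gaussian matrix. -/
theorem measurePreserving_mul_right (m : ℕ) {n : ℕ}
    (b : OrthonormalBasis (Fin n) ℂ (EuclideanSpace ℂ (Fin n))) :
    MeasurePreserving (fun (G : Fin m → Fin n → ℂ) i j => ∑ k, G i k * b k j)
      (cgaussMat m n) (cgaussMat m n) :=
  measurePreserving_pi (fun _ : Fin m => cgaussVec (Fin n)) (fun _ : Fin m => cgaussVec (Fin n))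
    fun _ => measurePreserving_cgaussVec b

/-- Multiplication on the left by a unitary matrix preserves the law of a Gaussian matrix. -/
theorem measurePreserving_mul_left {m : ℕ} (n : ℕ)
    (c : OrthonormalBasis (Fin m) ℂ (EuclideanSpace ℂ (Fin m))) :
    MeasurePreserving (fun (G : Fin m → Fin n → ℂ) i j => ∑ l, G l j * c l i)
      (cgaussMat m n) (cgaussMat m n) :=
  (measurePreserving_transpose n m).comp
    ((measurePreserving_mul_right n c).comp (measurePreserving_transpose m n))

theorem measurePreserving_cons_vec (n : ℕ) :
    MeasurePreserving (fun p : ℂ × (Fin n → ℂ) => (Fin.cons p.1 p.2 : Fin (n + 1) → ℂ))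
      (cgauss.prod (cgaussVec (Fin n))) (cgaussVec (Fin (n + 1))) := by
  have := (measurePreserving_piFinSuccAbove (fun _ : Fin (n + 1) => cgauss) 0).symm
  convert this using 1
  · ext p i
    refine Fin.cases ?_ (fun i => ?_) i <;> simp [MeasurableEquiv.piFinSuccAbove]
  · rfl
  · rfl

theorem measurePreserving_cons_row (m n : ℕ) :
    MeasurePreserving (fun p : (Fin n → ℂ) × (Fin m → Fin n → ℂ) =>
        (Fin.cons p.1 p.2 : Fin (m + 1) → Fin n → ℂ))
      ((cgaussVec (Fin n)).prod (cgaussMat m n)) (cgaussMat (m + 1) n) := by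
  have := (measurePreserving_piFinSuccAbove (fun _ : Fin (m + 1) => cgaussVec (Fin n)) 0).symm
  convert this using 1
  · ext p i
    refine Fin.cases ?_ (fun i => ?_) i <;> simp [MeasurableEquiv.piFinSuccAbove]
  · rfl
  · rfl

theorem measurePreserving_cons_col (m n : ℕ) :
    MeasurePreserving (fun (p : (Fin m → ℂ) × (Fin m → Fin n → ℂ)) i =>
        (Fin.cons (p.1 i) (p.2 i) : Fin (n + 1) → ℂ))
      ((cgaussVec (Fin m)).prod (cgaussMat m n)) (cgaussMat m (n + 1)) := by
  have h1 := (measurePreserving_arrowProdEquivProdArrow ℂ (Fin n → ℂ) (Fin m)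
    (fun _ => cgauss) (fun _ => cgaussVec (Fin n))).symm
  have h2 := measurePreserving_pi (fun _ : Fin m => cgauss.prod (cgaussVec (Fin n)))
    (fun _ : Fin m => cgaussVec (Fin (n + 1))) fun _ => measurePreserving_cons_vec n
  exact h2.comp h1

/-- In suitable orthonormal coordinates a vector is a nonnegative multiple of the first basis
vector. -/
theorem exists_orthonormalBasis_head {k : ℕ} (v : Fin k → ℂ) :
    ∃ b : OrthonormalBasis (Fin k) ℂ (EuclideanSpace ℂ (Fin k)), ∀ i,
      v i = ∑ l : Fin k, (if (l : ℕ) = 0 then (Real.sqrt (∑ j, ‖v j‖ ^ 2) : ℂ) else 0) * b l i := by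
  rcases k with _ | k
  · exact ⟨EuclideanSpace.basisFun _ _, fun i => i.elim0⟩
  by_cases hv : v = 0
  · refine ⟨EuclideanSpace.basisFun _ _, fun i => ?_⟩
    simp [hv]
  set V : EuclideanSpace ℂ (Fin (k + 1)) := WithLp.toLp 2 v with hV
  have hV0 : V ≠ 0 := by
    intro h
    apply hv
    ext i
    have := congrArg (fun w : EuclideanSpace ℂ (Fin (k + 1)) => w i) h
    simpa [hV] using this
  have hn : ‖V‖ = Real.sqrt (∑ j, ‖v j‖ ^ 2) := EuclideanSpace.norm_eq V
  have hu : Orthonormal ℂ (({0} : Set (Fin (k + 1))).domRestrict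
      fun _ => ((‖V‖⁻¹ : ℝ) : ℂ) • V) := by
    constructor
    · intro i
      simp only [Set.domRestrict_apply]
      rw [norm_smul, Complex.norm_real, norm_inv, norm_norm,
        inv_mul_cancel₀ (norm_ne_zero_iff.2 hV0)]
    · intro i j hij
      exact absurd (Subsingleton.elim i j) hij
  obtain ⟨b, hb⟩ := hu.exists_orthonormalBasis_extension_of_card_eq
    (by simp)
  refine ⟨b, fun i => ?_⟩
  rw [← hn, Fin.sum_univ_succ]
  have hb0 := hb 0 rfl
  have : ((‖V‖ : ℝ) : ℂ) ≠ 0 := by simpa using hV0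
  simp [hb0, hV]
  field_simp
  rw [← hV, mul_div_cancel_right₀ _ this]

/-! ### One step of the bidiagonalisation -/

/-- The quadratic form `x ↦ ‖Gᵀ x‖²` of a matrix `G`. -/
noncomputable def rowForm {m n : ℕ} (G : Fin m → Fin n → ℂ) (x : Fin m → ℂ) : ℝ :=
  ∑ j, ‖∑ i, x i * G i j‖ ^ 2

/-- The quadratic form `x ↦ τ |x₀|²` (which is zero in dimension zero). -/
noncomputable def headForm {m : ℕ} (τ : ℝ) (x : Fin m → ℂ) : ℝ :=
  ∑ i : Fin m, if (i : ℕ) = 0 then τ * ‖x i‖ ^ 2 else 0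

/-- The matrices `G` with `σ ‖Gᵀ x‖² + τ |x₀|² ≤ Λ ‖x‖²` for all `x`. For `σ = 1` this is an upper
bound on the singular values of `G`, for `σ = -1` a lower bound. -/
def formBounded (m n : ℕ) (σ τ Λ : ℝ) : Set (Fin m → Fin n → ℂ) :=
  {G | ∀ x : Fin m → ℂ, σ * rowForm G x + headForm τ x ≤ Λ * ∑ i, ‖x i‖ ^ 2}

theorem measurableSet_formBounded (m n : ℕ) (σ τ Λ : ℝ) :
    MeasurableSet (formBounded m n σ τ Λ) := by
  apply IsClosed.measurableSet
  simp only [formBounded, Set.ofPred_forall]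
  refine isClosed_iInter fun x => isClosed_le ?_ continuous_const
  unfold rowForm
  fun_prop

theorem headForm_mono {m : ℕ} {τ τ' : ℝ} (h : τ ≤ τ') (x : Fin m → ℂ) :
    headForm τ x ≤ headForm τ' x := by
  unfold headForm
  gcongr
  split_ifs
  · gcongr
  · exact le_rfl

theorem formBounded_anti {m n : ℕ} {σ τ τ' Λ : ℝ} (h : τ ≤ τ') :
    formBounded m n σ τ' Λ ⊆ formBounded m n σ τ Λ := fun G hG x =>
  le_trans (by gcongr; exact headForm_mono h x) (hG x)

theorem sum_norm_sq_comb {k : ℕ}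
    (b : OrthonormalBasis (Fin k) ℂ (EuclideanSpace ℂ (Fin k))) (a : Fin k → ℂ) :
    ∑ j, ‖∑ l, a l * b l j‖ ^ 2 = ∑ l, ‖a l‖ ^ 2 := by
  have h := b.repr.symm.norm_map (WithLp.toLp 2 a)
  have h2 : ‖b.repr.symm (WithLp.toLp 2 a)‖ ^ 2 =
      ‖(WithLp.toLp 2 a : EuclideanSpace ℂ (Fin k))‖ ^ 2 := by
    rw [h]
  rw [EuclideanSpace.norm_sq_eq, EuclideanSpace.norm_sq_eq, ← b.sum_repr_symm] at h2
  simpa using h2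

theorem sum_norm_sq_coord {k : ℕ}
    (c : OrthonormalBasis (Fin k) ℂ (EuclideanSpace ℂ (Fin k))) (x : Fin k → ℂ) :
    ∑ l, ‖∑ i, x i * c l i‖ ^ 2 = ∑ i, ‖x i‖ ^ 2 := by
  have h2 := c.sum_sq_norm_inner_right (WithLp.toLp 2 fun i => star (x i))
  rw [EuclideanSpace.norm_sq_eq] at h2
  simp only [PiLp.inner_apply, RCLike.inner_apply] at h2
  convert h2 using 3 with k _ k _
  · rw [← norm_star, star_sum]
    simp
  · simp

/-- The cross terms of `σ |u d + w e|²` are split evenly between `|u|²` and `|w|²`; this is the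
Gershgorin bound for the tridiagonal matrix of a bidiagonal model. -/
theorem sign_mul_norm_sq_le {σ : ℝ} (hσ : σ = 1 ∨ σ = -1) {d e : ℝ} (hd : 0 ≤ d) (he : 0 ≤ e)
    (u w : ℂ) : σ * ‖u * d + w * e‖ ^ 2 ≤
      (σ * d ^ 2 + d * e) * ‖u‖ ^ 2 + (σ * e ^ 2 + d * e) * ‖w‖ ^ 2 := by
  have hu : ‖u * d‖ = ‖u‖ * d := by rw [norm_mul, Complex.norm_real, Real.norm_of_nonneg hd]
  have hw : ‖w * e‖ = ‖w‖ * e := by rw [norm_mul, Complex.norm_real, Real.norm_of_nonneg he]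
  have hcross : 2 * (‖u‖ * ‖w‖) * (d * e) ≤ (‖u‖ ^ 2 + ‖w‖ ^ 2) * (d * e) := by
    have := two_mul_le_add_sq ‖u‖ ‖w‖
    have : 2 * (‖u‖ * ‖w‖) ≤ ‖u‖ ^ 2 + ‖w‖ ^ 2 := by linarith
    gcongr
  rcases hσ with rfl | rfl
  · have h1 : ‖u * d + w * e‖ ≤ ‖u‖ * d + ‖w‖ * e := by
      rw [← hu, ← hw]; exact norm_add_le _ _
    have h2 : ‖u * d + w * e‖ ^ 2 ≤ (‖u‖ * d + ‖w‖ * e) ^ 2 := by gcongr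
    nlinarith
  · have h1 : |‖u‖ * d - ‖w‖ * e| ≤ ‖u * d + w * e‖ := by
      rw [← hu, ← hw]
      simpa using abs_norm_sub_norm_le (u * d) (-(w * e))
    have h2 : |‖u‖ * d - ‖w‖ * e| ^ 2 ≤ ‖u * d + w * e‖ ^ 2 := by gcongr
    rw [sq_abs] at h2
    nlinarith

/-- The deterministic step: in coordinates adapted to the first row (of length `d`) and then to the
rest of the first column (of length `e`), a form bound for the remaining `m × n` block `K` gives a
form bound for the whole matrix. -/
theorem cons_mem_formBounded {m n : ℕ} {σ τ Λ d e : ℝ} (hσ : σ = 1 ∨ σ = -1) (hd : 0 ≤ d)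
    (he : 0 ≤ e) (b : OrthonormalBasis (Fin (n + 1)) ℂ (EuclideanSpace ℂ (Fin (n + 1))))
    (c : OrthonormalBasis (Fin m) ℂ (EuclideanSpace ℂ (Fin m)))
    {g : Fin (n + 1) → ℂ}
    (hg : ∀ j, g j = ∑ l : Fin (n + 1), (if (l : ℕ) = 0 then (d : ℂ) else 0) * b l j)
    {h : Fin m → ℂ}
    (hh : ∀ i, h i = ∑ l : Fin m, (if (l : ℕ) = 0 then (e : ℂ) else 0) * c l i)
    (K : Fin m → Fin n → ℂ) (hK : K ∈ formBounded m n σ (σ * e ^ 2 + d * e) Λ)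
    (hτ : σ * d ^ 2 + d * e + τ ≤ Λ) :
    (Fin.cons g (fun i j => ∑ k, (Fin.cons (h i) (fun k => ∑ l, K l k * c l i) :
      Fin (n + 1) → ℂ) k * b k j) : Fin (m + 1) → Fin (n + 1) → ℂ) ∈
      formBounded (m + 1) (n + 1) σ τ Λ := by
  intro x
  set x' : Fin m → ℂ := fun l => ∑ i, x i.succ * c l i with hx'
  have hnorm : ∑ l, ‖x' l‖ ^ 2 = ∑ i : Fin m, ‖x i.succ‖ ^ 2 :=
    sum_norm_sq_coord c _
  set W : ℂ := ∑ l : Fin m, (if (l : ℕ) = 0 then x' l else 0) with hW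
  -- the form in the adapted coordinates
  have hform : rowForm (Fin.cons g (fun i j => ∑ k, (Fin.cons (h i) (fun k => ∑ l, K l k * c l i) :
      Fin (n + 1) → ℂ) k * b k j) : Fin (m + 1) → Fin (n + 1) → ℂ) x =
      ‖x 0 * d + W * e‖ ^ 2 + rowForm K x' := by
    have h1 : ∀ j, ∑ i, x i * (Fin.cons g (fun i j => ∑ k, (Fin.cons (h i)
        (fun k => ∑ l, K l k * c l i) : Fin (n + 1) → ℂ) k * b k j) :
          Fin (m + 1) → Fin (n + 1) → ℂ) i j =
        ∑ l, (Fin.cons (x 0 * d + W * e) (fun k => ∑ l, x' l * K l k) : Fin (n + 1) → ℂ) l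
          * b l j := by
      intro j
      rw [Fin.sum_univ_succ]
      simp only [Fin.cons_zero, Fin.cons_succ, hg]
      have e1 : ∑ i : Fin m, x i.succ * ∑ k, (Fin.cons (h i) (fun k => ∑ l, K l k * c l i) :
          Fin (n + 1) → ℂ) k * b k j = ∑ k, (∑ i : Fin m, x i.succ * (Fin.cons (h i)
            (fun k => ∑ l, K l k * c l i) : Fin (n + 1) → ℂ) k) * b k j := by
        simp_rw [Finset.mul_sum, Finset.sum_mul]
        rw [Finset.sum_comm]
        simp_rw [mul_assoc]
      rw [e1, Fin.sum_univ_succ, Fin.sum_univ_succ, Fin.sum_univ_succ]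
      simp only [Fin.cons_zero, Fin.cons_succ, Fin.val_zero, Fin.val_succ, if_true,
        Nat.succ_ne_zero, if_false, zero_mul, Finset.sum_const_zero, add_zero]
      have e2 : ∑ i : Fin m, x i.succ * h i = W * e := by
        simp_rw [hh, hW, hx', Finset.mul_sum, Finset.sum_mul]
        rw [Finset.sum_comm]
        refine Finset.sum_congr rfl fun l _ => ?_
        split_ifs
        · rw [Finset.sum_mul]
          exact Finset.sum_congr rfl fun i _ => by ring
        · simp
      have e3 : ∀ k : Fin n, ∑ i : Fin m, x i.succ * ∑ l, K l k * c l i =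
          ∑ l, x' l * K l k := by
        intro k
        simp_rw [hx', Finset.mul_sum, Finset.sum_mul]
        rw [Finset.sum_comm]
        exact Finset.sum_congr rfl fun i _ => Finset.sum_congr rfl fun l _ => by ring
      rw [e2]
      simp_rw [e3]
      ring
    unfold rowForm
    simp_rw [h1]
    rw [sum_norm_sq_comb, Fin.sum_univ_succ]
    simp only [Fin.cons_zero, Fin.cons_succ]
  have hhead : headForm τ x = τ * ‖x 0‖ ^ 2 := by
    unfold headForm
    rw [Fin.sum_univ_succ]
    simp
  have hWhead : ∀ ρ : ℝ, headForm ρ x' = ρ * ‖W‖ ^ 2 := by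
    intro ρ
    unfold headForm
    rw [hW]
    rcases m with _ | m
    · simp
    · rw [Fin.sum_univ_succ, Fin.sum_univ_succ]
      simp
  have h1 := hK x'
  rw [hWhead, hnorm] at h1
  have h2 := sign_mul_norm_sq_le hσ hd he (x 0) W
  have h3 : (σ * d ^ 2 + d * e + τ) * ‖x 0‖ ^ 2 ≤ Λ * ‖x 0‖ ^ 2 := by gcongr
  rw [hform, hhead, Fin.sum_univ_succ]
  nlinarith

/-! ### The recursion for the failure probability -/

/-- A union bound through Fubini: a set of the product is small if its sections are, outside a small
set `A` of first coordinates. -/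
theorem measureReal_prod_le {X Y : Type*} [MeasurableSpace X] [MeasurableSpace Y]
    (μ : Measure X) (ν : Measure Y) [IsProbabilityMeasure μ] [IsProbabilityMeasure ν]
    {s : Set (X × Y)} (hs : MeasurableSet s) {A : Set X} (hA : MeasurableSet A) {K : ℝ}
    (hK : 0 ≤ K) (h : ∀ x, x ∉ A → ν.real (Prod.mk x ⁻¹' s) ≤ K) :
    (μ.prod ν).real s ≤ μ.real A + K := by
  have h1 : (μ.prod ν) s ≤ μ A + ENNReal.ofReal K := by
    rw [Measure.prod_apply hs]
    calc ∫⁻ x, ν (Prod.mk x ⁻¹' s) ∂μ ≤ ∫⁻ x, (A.indicator 1 x + ENNReal.ofReal K) ∂μ := by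
          refine lintegral_mono fun x => ?_
          by_cases hx : x ∈ A
          · simp only [hx, Set.indicator_of_mem, Pi.one_apply]
            exact le_trans prob_le_one le_self_add
          · simp only [hx, not_false_eq_true, Set.indicator_of_notMem, zero_add]
            rw [← ofReal_measureReal]
            exact ENNReal.ofReal_le_ofReal (h x hx)
      _ = μ A + ENNReal.ofReal K := by
          rw [lintegral_add_right _ measurable_const, lintegral_indicator_one hA]
          simp
  have h2 := ENNReal.toReal_mono (by finiteness) h1
  rwa [ENNReal.toReal_add (by finiteness) (by finiteness), ENNReal.toReal_ofReal hK] at h2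

/-- The vectors of `ℂ^k` whose squared length deviates from its mean `k` by at least `s`. -/
def normDeviant (k : ℕ) (s : ℝ) : Set (Fin k → ℂ) := {z | s ≤ |∑ i, ‖z i‖ ^ 2 - k|}

theorem measurableSet_normDeviant (k : ℕ) (s : ℝ) : MeasurableSet (normDeviant k s) := by
  apply IsClosed.measurableSet
  unfold normDeviant
  exact isClosed_le continuous_const (by fun_prop)

/-- The failure probability for an `(m + 1) × (n + 1)` Gaussian matrix is at most that for an
`m × n` one plus the probabilities that the two lengths split off are atypical. Given the first row
`g` and then the column `h`, the adapted coordinates are fixed, so that unitary invariance applies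
to what remains and the coordinates need not depend measurably on `g` and `h`. -/
theorem cgaussMat_formBounded_step {m n : ℕ} {σ τ τ' Λ s : ℝ} (hσ : σ = 1 ∨ σ = -1)
    (hstep : ∀ d e : ℝ, 0 ≤ d → 0 ≤ e → |d ^ 2 - (n + 1)| < s → |e ^ 2 - m| < s →
      σ * d ^ 2 + d * e + τ ≤ Λ ∧ σ * e ^ 2 + d * e ≤ τ') :
    (cgaussMat (m + 1) (n + 1)).real (formBounded (m + 1) (n + 1) σ τ Λ)ᶜ ≤
      (cgaussVec (Fin (n + 1))).real (normDeviant (n + 1) s) +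
        ((cgaussVec (Fin m)).real (normDeviant m s) +
          (cgaussMat m n).real (formBounded m n σ τ' Λ)ᶜ) := by
  have hbad := (measurableSet_formBounded (m + 1) (n + 1) σ τ Λ).compl
  rw [← (measurePreserving_cons_row m (n + 1)).measureReal_preimage hbad.nullMeasurableSet]
  have hrow := (measurePreserving_cons_row m (n + 1)).measurable hbad
  refine measureReal_prod_le _ _ hrow (measurableSet_normDeviant _ _) (by positivity) ?_
  intro g hg
  obtain ⟨b, hb⟩ := exists_orthonormalBasis_head g
  have hslice := measurable_prodMk_left (x := g) hrow
  rw [← (measurePreserving_mul_right m b).measureReal_preimage hslice.nullMeasurableSet]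
  have hslice' := (measurePreserving_mul_right m b).measurable hslice
  rw [← (measurePreserving_cons_col m n).measureReal_preimage hslice'.nullMeasurableSet]
  have hcol := (measurePreserving_cons_col m n).measurable hslice'
  refine measureReal_prod_le _ _ hcol (measurableSet_normDeviant _ _) (by positivity) ?_
  intro h hh
  obtain ⟨c, hc⟩ := exists_orthonormalBasis_head h
  have hslice2 := measurable_prodMk_left (x := h) hcol
  rw [← (measurePreserving_mul_left n c).measureReal_preimage hslice2.nullMeasurableSet]
  refine measureReal_mono fun K hK hKgood => hK ?_
  simp only [normDeviant, Set.mem_ofPred_eq, not_le] at hg hh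
  obtain ⟨h1, h2⟩ := hstep _ _ (Real.sqrt_nonneg (∑ j, ‖g j‖ ^ 2))
    (Real.sqrt_nonneg (∑ j, ‖h j‖ ^ 2))
    (by rw [Real.sq_sqrt (by positivity)]; exact_mod_cast hg)
    (by rw [Real.sq_sqrt (by positivity)]; exact hh)
  exact cons_mem_formBounded hσ (Real.sqrt_nonneg _) (Real.sqrt_nonneg _) b c hb hc K
    (formBounded_anti h2 hKgood) h1

/-- At a fixed difference `a - b`, the difference `√a - √b` decreases as `a` and `b` grow. Hence the
rows split off first determine the lower edge. -/
theorem sq_sqrt_sub_sqrt_le {a b a' b' : ℝ} (hb : 0 < b) (hab : b ≤ a) (hbb : b ≤ b')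
    (h : a' - b' = a - b) :
    (Real.sqrt a' - Real.sqrt b') ^ 2 ≤ (Real.sqrt a - Real.sqrt b) ^ 2 := by
  have ha' : a ≤ a' := by linarith
  have e1 : Real.sqrt a * Real.sqrt a = a := Real.mul_self_sqrt (by linarith)
  have e2 : Real.sqrt b * Real.sqrt b = b := Real.mul_self_sqrt (by linarith)
  have e3 : Real.sqrt a' * Real.sqrt a' = a' := Real.mul_self_sqrt (by linarith)
  have e4 : Real.sqrt b' * Real.sqrt b' = b' := Real.mul_self_sqrt (by linarith)
  have p2 : 0 < Real.sqrt b := Real.sqrt_pos.2 hb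
  have l1 : Real.sqrt b ≤ Real.sqrt a := Real.sqrt_le_sqrt hab
  have l2 : Real.sqrt b' ≤ Real.sqrt a' := Real.sqrt_le_sqrt (by linarith)
  have l3 : Real.sqrt a ≤ Real.sqrt a' := Real.sqrt_le_sqrt ha'
  have l4 : Real.sqrt b ≤ Real.sqrt b' := Real.sqrt_le_sqrt hbb
  have key : Real.sqrt a' - Real.sqrt b' ≤ Real.sqrt a - Real.sqrt b := by
    have h5 : (Real.sqrt a' - Real.sqrt b') * (Real.sqrt a' + Real.sqrt b') =
        (Real.sqrt a - Real.sqrt b) * (Real.sqrt a + Real.sqrt b) := by nlinarith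
    have h6 : (Real.sqrt a' - Real.sqrt b') * (Real.sqrt a + Real.sqrt b) ≤
        (Real.sqrt a' - Real.sqrt b') * (Real.sqrt a' + Real.sqrt b') := by
      gcongr
    rw [h5] at h6
    exact le_of_mul_le_mul_right h6 (by linarith)
  have : 0 ≤ Real.sqrt a' - Real.sqrt b' := by linarith
  gcongr

/-- A Gershgorin bound for the bidiagonal model: the row of the tridiagonal matrix with the two
neighbouring pairs of lengths. -/
theorem gershgorin_row {σ s a b d e : ℝ} (hσ : σ = 1 ∨ σ = -1) (he : 0 ≤ e)
    (h1 : |d ^ 2 - a| < s) (h2 : |e ^ 2 - b| < s) :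
    σ * e ^ 2 + d * e ≤ σ * b + s + Real.sqrt (a + s) * Real.sqrt (b + s) ∧
    σ * d ^ 2 + d * e ≤ σ * a + s + Real.sqrt (a + s) * Real.sqrt (b + s) := by
  obtain ⟨h1l, h1r⟩ := abs_lt.1 h1
  obtain ⟨h2l, h2r⟩ := abs_lt.1 h2
  have l1 : d ≤ Real.sqrt (a + s) := Real.le_sqrt_of_sq_le (by linarith)
  have l2 : e ≤ Real.sqrt (b + s) := Real.le_sqrt_of_sq_le (by linarith)
  have l3 : d * e ≤ Real.sqrt (a + s) * Real.sqrt (b + s) := by gcongr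
  rcases hσ with rfl | rfl <;> constructor <;> linarith

/-- Bounds on the spectrum of a Gaussian matrix with explicit constants, valid outside an event of
small probability: the union bound over the steps of the bidiagonalisation. With `D = n - m₀` fixed,
both dimensions decrease together, and `T` bounds the probability of an atypical length. -/
theorem cgaussMat_formBounded {σ s T : ℝ} (hσ : σ = 1 ∨ σ = -1) (hs : 0 < s) (D m₀ : ℕ)
    (hT : ∀ k : ℕ, k ≤ m₀ + D → (cgaussVec (Fin k)).real (normDeviant k s) ≤ T) :
    (cgaussMat m₀ (m₀ + D)).real (formBounded m₀ (m₀ + D) σ 0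
      (σ * (Real.sqrt (m₀ + D + 1 + s) + σ * Real.sqrt (m₀ + s)) ^ 2 + 4 * s + 1))ᶜ ≤
      m₀ * (2 * T) := by
  set Λ : ℝ := σ * (Real.sqrt (m₀ + D + 1 + s) + σ * Real.sqrt (m₀ + s)) ^ 2 + 4 * s + 1 with hΛ
  -- the weight left on the first coordinate by the row split off before the `m × (m + D)` block
  set τ : ℕ → ℝ := fun m => σ * m + s + Real.sqrt (m + D + 1 + s) * Real.sqrt (m + s) with hτ
  have hind : ∀ m : ℕ, m ≤ m₀ →
      (cgaussMat m (m + D)).real (formBounded m (m + D) σ (τ m) Λ)ᶜ ≤ m * (2 * T) := by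
    intro m
    induction m with
    | zero =>
      intro _
      have : formBounded 0 (0 + D) σ (τ 0) Λ = Set.univ := by
        ext G
        simp [formBounded, rowForm, headForm]
      rw [this]
      simp
    | succ m ih =>
      intro hm
      have ih' := ih (by omega)
      have hm' : (m : ℝ) + 1 ≤ m₀ := by exact_mod_cast hm
      have hm0 : (0 : ℝ) ≤ m := Nat.cast_nonneg m
      have hD0 : (0 : ℝ) ≤ D := Nat.cast_nonneg D
      rw [show m + 1 + D = m + D + 1 by ring]
      have hst := cgaussMat_formBounded_step (m := m) (n := m + D) (σ := σ) (τ := τ (m + 1))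
        (τ' := τ m) (Λ := Λ) (s := s) hσ (by
          intro d e _ he h1 h2
          push_cast at h1
          obtain ⟨g1, g2⟩ := gershgorin_row hσ he h1 h2
          refine ⟨?_, g1⟩
          set a := Real.sqrt (m + 1 + D + 1 + s) with ha
          set b := Real.sqrt (m + 1 + s) with hb
          have haa : a * a = m + 1 + D + 1 + s := Real.mul_self_sqrt (by positivity)
          have hbb : b * b = m + 1 + s := Real.mul_self_sqrt (by positivity)
          have ha' : Real.sqrt (m + D + 1 + s) ≤ a := Real.sqrt_le_sqrt (by linarith)
          have hb' : Real.sqrt (m + s) ≤ b := Real.sqrt_le_sqrt (by linarith)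
          have hab : Real.sqrt (m + D + 1 + s) * Real.sqrt (m + s) ≤ a * b := by gcongr
          have hτ1 : τ (m + 1) = σ * (m + 1) + s + a * b := by
            simp only [hτ, ha, hb]
            push_cast
            ring
          have hmain : σ * (a + σ * b) ^ 2 ≤
              σ * (Real.sqrt (m₀ + D + 1 + s) + σ * Real.sqrt (m₀ + s)) ^ 2 := by
            rcases hσ with rfl | rfl
            · have q1 : a ≤ Real.sqrt (m₀ + D + 1 + s) := Real.sqrt_le_sqrt (by linarith)
              have q2 : b ≤ Real.sqrt (m₀ + s) := Real.sqrt_le_sqrt (by linarith)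
              have q3 : 0 ≤ a := Real.sqrt_nonneg _
              have q4 : 0 ≤ b := Real.sqrt_nonneg _
              gcongr
            · have := sq_sqrt_sub_sqrt_le (a := (m : ℝ) + 1 + D + 1 + s) (b := (m : ℝ) + 1 + s)
                (a' := (m₀ : ℝ) + D + 1 + s) (b' := (m₀ : ℝ) + s) (by positivity) (by linarith)
                (by linarith) (by ring)
              rw [← ha, ← hb] at this
              nlinarith
          rw [hτ1]
          rcases hσ with rfl | rfl <;> nlinarith)
      refine hst.trans ?_
      have t1 := hT (m + D + 1) (by omega)
      have t2 := hT m (by omega)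
      push_cast
      linarith
  have h0 : 0 ≤ τ m₀ := by
    have l : Real.sqrt (m₀ + s) * Real.sqrt (m₀ + s) = m₀ + s :=
      Real.mul_self_sqrt (by positivity)
    have l2 : Real.sqrt (m₀ + s) ≤ Real.sqrt (m₀ + D + 1 + s) :=
      Real.sqrt_le_sqrt (by linarith [(Nat.cast_nonneg D : (0 : ℝ) ≤ D)])
    have l3 : Real.sqrt (m₀ + s) * Real.sqrt (m₀ + s) ≤
      Real.sqrt (m₀ + D + 1 + s) * Real.sqrt (m₀ + s) := by gcongr
    have hm0 : (0 : ℝ) ≤ m₀ := Nat.cast_nonneg m₀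
    simp only [hτ]
    rcases hσ with rfl | rfl <;> linarith
  refine le_trans (measureReal_mono ?_) (hind m₀ le_rfl)
  exact Set.compl_subset_compl.2 (formBounded_anti h0)

/-! ### Singular values of Gaussian matrices -/

/-- The vector `Gᵀ x`. -/
noncomputable def act {m n : ℕ} (G : Fin m → Fin n → ℂ) (x : EuclideanSpace ℂ (Fin m)) :
    EuclideanSpace ℂ (Fin n) :=
  WithLp.toLp 2 fun j => ∑ i, x i * G i j

theorem norm_act_sq {m n : ℕ} (G : Fin m → Fin n → ℂ) (x : EuclideanSpace ℂ (Fin m)) :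
    ‖act G x‖ ^ 2 = rowForm G x := by
  rw [EuclideanSpace.norm_sq_eq]
  rfl

/-- The singular values of the `m × n` matrix `G`, `m ≤ n`, lie between `l` and `u`. -/
def SingularBounds {m n : ℕ} (G : Fin m → Fin n → ℂ) (l u : ℝ) : Prop :=
  ∀ x : EuclideanSpace ℂ (Fin m), l * ‖x‖ ≤ ‖act G x‖ ∧ ‖act G x‖ ≤ u * ‖x‖

theorem isClosed_singularBounds (m n : ℕ) (l u : ℝ) :
    IsClosed {G : Fin m → Fin n → ℂ | SingularBounds G l u} := by
  simp only [SingularBounds, Set.ofPred_forall, Set.ofPred_and]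
  refine isClosed_iInter fun x => ?_
  have h : Continuous fun G : Fin m → Fin n → ℂ => ‖act G x‖ := by
    unfold act
    fun_prop
  exact (isClosed_le continuous_const h).inter (isClosed_le h continuous_const)

/-- The matrices whose singular values are within `ρ √n` of the Marchenko–Pastur range
`[(1 - √c) √n, (1 + √c) √n]` and whose rows have lengths within `ρ √n` of `√n`. -/
def typicalMat (m n : ℕ) (c ρ : ℝ) : Set (Fin m → Fin n → ℂ) :=
  {G | SingularBounds G ((1 - Real.sqrt c - ρ) * Real.sqrt n) ((1 + Real.sqrt c + ρ) * Real.sqrt n)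
    ∧ ∀ i, |‖(WithLp.toLp 2 (G i) : EuclideanSpace ℂ (Fin n))‖ - Real.sqrt n| ≤ ρ * Real.sqrt n}

theorem measurableSet_typicalMat (m n : ℕ) (c ρ : ℝ) : MeasurableSet (typicalMat m n c ρ) := by
  apply IsClosed.measurableSet
  unfold typicalMat
  simp only [Set.ofPred_and, Set.ofPred_forall]
  refine (isClosed_singularBounds _ _ _ _).inter (isClosed_iInter fun i => isClosed_le ?_
    continuous_const)
  fun_prop

theorem singularBounds_of_formBounded {m n : ℕ} {G : Fin m → Fin n → ℂ} {l u Λ₁ Λ₂ : ℝ}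
    (hu : 0 ≤ u) (h1 : G ∈ formBounded m n 1 0 Λ₁) (h2 : G ∈ formBounded m n (-1) 0 Λ₂)
    (hΛ₁ : Λ₁ ≤ u ^ 2) (hΛ₂ : 0 < l → Λ₂ ≤ -l ^ 2) : SingularBounds G l u := by
  intro x
  have hx : ∑ i, ‖x i‖ ^ 2 = ‖x‖ ^ 2 := (EuclideanSpace.norm_sq_eq x).symm
  have hh : headForm 0 (fun i => x i) = 0 := by simp [headForm]
  have a1 := h1 x
  have a2 := h2 x
  rw [hh, hx, ← norm_act_sq] at a1 a2
  constructor
  · rcases le_or_gt l 0 with hl | hl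
    · exact (mul_nonpos_of_nonpos_of_nonneg hl (norm_nonneg x)).trans (norm_nonneg _)
    · rw [← sq_le_sq₀ (by positivity) (norm_nonneg _)]
      have : Λ₂ * ‖x‖ ^ 2 ≤ -l ^ 2 * ‖x‖ ^ 2 := by gcongr; exact hΛ₂ hl
      nlinarith
  · rw [← sq_le_sq₀ (norm_nonneg _) (by positivity)]
    have : Λ₁ * ‖x‖ ^ 2 ≤ u ^ 2 * ‖x‖ ^ 2 := by gcongr
    nlinarith

theorem rowNorm_close {n : ℕ} {z : Fin n → ℂ} {ρ : ℝ} (h : |∑ i, ‖z i‖ ^ 2 - n| < ρ * n) :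
    |‖(WithLp.toLp 2 z : EuclideanSpace ℂ (Fin n))‖ - Real.sqrt n| ≤ ρ * Real.sqrt n := by
  have hn : (0 : ℝ) < Real.sqrt n := by
    apply Real.sqrt_pos.2
    rcases n with _ | n
    · simp at h
    · positivity
  have e1 : ∑ i, ‖z i‖ ^ 2 = ‖(WithLp.toLp 2 z : EuclideanSpace ℂ (Fin n))‖ ^ 2 :=
    (EuclideanSpace.norm_sq_eq (WithLp.toLp 2 z : EuclideanSpace ℂ (Fin n))).symm
  have e2 : (n : ℝ) = Real.sqrt n ^ 2 := (Real.sq_sqrt (Nat.cast_nonneg n)).symm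
  have ht := norm_nonneg (WithLp.toLp 2 z : EuclideanSpace ℂ (Fin n))
  rw [e1, e2] at h
  generalize ‖(WithLp.toLp 2 z : EuclideanSpace ℂ (Fin n))‖ = t at h ht ⊢
  generalize Real.sqrt n = r at h hn ⊢
  have h1 : |t - r| * r ≤ |t ^ 2 - r ^ 2| := by
    rw [show t ^ 2 - r ^ 2 = (t - r) * (t + r) by ring, abs_mul,
      abs_of_nonneg (by linarith : 0 ≤ t + r)]
    gcongr
    linarith
  have h2 : |t - r| * r ≤ ρ * r * r := by nlinarith
  exact le_of_mul_le_mul_right h2 hn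

/-- A Gaussian matrix of aspect ratio near `c` is typical with overwhelming probability: as the
slack and `1 / n` tend to `0` and `m / n` tends to `c`, the explicit spectral bounds, divided by
`n`, tend to `(1 ± √c)²`. -/
theorem cgaussMat_typical {c ρ : ℝ} (hc0 : 0 < c) (hc1 : c < 1) (hρ : 0 < ρ) :
    ∃ κ : ℝ, 0 < κ ∧ ∀ m n : ℕ, 1 ≤ κ * n → |(m : ℝ) / n - c| ≤ κ →
      (cgaussMat m n).real (typicalMat m n c ρ)ᶜ ≤ 10 * n * Real.exp (-(κ * n)) := by
  -- the two edges, as functions of the slack, of `1 / n` and of `m / n`, in units of `n`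
  have hup : ContinuousAt (fun p : ℝ × ℝ × ℝ => (Real.sqrt (1 + p.2.1 + p.1) +
      Real.sqrt (p.2.2 + p.1)) ^ 2 + 4 * p.1 + p.2.1) (0, 0, c) := by fun_prop
  have hlow : ContinuousAt (fun p : ℝ × ℝ × ℝ => (Real.sqrt (1 + p.2.1 + p.1) -
      Real.sqrt (p.2.2 + p.1)) ^ 2 - 4 * p.1 - p.2.1) (0, 0, c) := by fun_prop
  have hsc : Real.sqrt c < 1 := by rw [Real.sqrt_lt' one_pos]; simpa using hc1
  have hsc0 : 0 ≤ Real.sqrt c := Real.sqrt_nonneg c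
  have ev : ∀ᶠ p in 𝓝 ((0, 0, c) : ℝ × ℝ × ℝ),
      (Real.sqrt (1 + p.2.1 + p.1) + Real.sqrt (p.2.2 + p.1)) ^ 2 + 4 * p.1 + p.2.1 <
        (1 + Real.sqrt c + ρ) ^ 2 ∧ (0 < 1 - Real.sqrt c - ρ → (1 - Real.sqrt c - ρ) ^ 2 <
        (Real.sqrt (1 + p.2.1 + p.1) - Real.sqrt (p.2.2 + p.1)) ^ 2 - 4 * p.1 - p.2.1) := by
    refine (hup.eventually_lt continuousAt_const ?_).and ?_
    · simp
      nlinarith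
    · by_cases h : 0 < 1 - Real.sqrt c - ρ
      · filter_upwards [(continuousAt_const (y := (1 - Real.sqrt c - ρ) ^ 2)).eventually_lt hlow
          (by simp; nlinarith)] with p hp _
        exact hp
      · exact Eventually.of_forall fun p hp => absurd hp h
  obtain ⟨r, hr, hball⟩ := Metric.eventually_nhds_iff.1 ev
  set η := min (r / 2) (min 1 ρ) with hη
  have hη0 : 0 < η := by positivity
  have hη1 : η ≤ 1 := (min_le_right _ _).trans (min_le_left _ _)
  have hηρ : η ≤ ρ := (min_le_right _ _).trans (min_le_right _ _)
  have hηr : η < r := (min_le_left _ _).trans_lt (by linarith)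
  refine ⟨min (η ^ 2 / 4) (min (r / 2) (1 - c)), by
    have : 0 < 1 - c := by linarith
    positivity, ?_⟩
  set κ := min (η ^ 2 / 4) (min (r / 2) (1 - c)) with hκ
  have hκ1 : κ ≤ η ^ 2 / 4 := min_le_left _ _
  have hκ2 : κ ≤ r / 2 := (min_le_right _ _).trans (min_le_left _ _)
  have hκ3 : κ ≤ 1 - c := (min_le_right _ _).trans (min_le_right _ _)
  intro m n hn hmn
  have hn0 : (0 : ℝ) < n := by
    rcases Nat.eq_zero_or_pos n with h | h
    · subst h; norm_num at hn
    · exact_mod_cast h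
  have hmle : m ≤ n := by
    have := (abs_le.1 hmn).2
    have h2 : (m : ℝ) / n ≤ 1 := by linarith
    rw [div_le_one hn0] at h2
    exact_mod_cast h2
  set s : ℝ := η * n with hs
  have hs0 : 0 < s := by positivity
  set T : ℝ := 2 * Real.exp (-(κ * n)) with hTdef
  have hT : ∀ k : ℕ, k ≤ n → (cgaussVec (Fin k)).real (normDeviant k s) ≤ T := by
    intro k hk
    have h1 := cgaussVec_norm_sq_concentration (Fin k) (K := n) (s := s) hn0
      (by simpa using hk) hs0.le (by rw [hs]; nlinarith)
    rw [Fintype.card_fin] at h1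
    refine h1.trans ?_
    rw [hTdef]
    have : κ * n ≤ s ^ 2 / (4 * n) := by
      rw [hs, le_div_iff₀ (by positivity)]
      nlinarith [mul_pos hn0 hn0]
    gcongr
  obtain ⟨D, rfl⟩ := Nat.exists_eq_add_of_le hmle
  have b1 := cgaussMat_formBounded (σ := 1) (Or.inl rfl) hs0 D m hT
  have b2 := cgaussMat_formBounded (σ := -1) (Or.inr rfl) hs0 D m hT
  set Λ₁ : ℝ := 1 * (Real.sqrt (m + D + 1 + s) + 1 * Real.sqrt (m + s)) ^ 2 + 4 * s + 1 with hΛ₁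
  set Λ₂ : ℝ := -1 * (Real.sqrt (m + D + 1 + s) + -1 * Real.sqrt (m + s)) ^ 2 + 4 * s + 1 with hΛ₂
  set N : ℝ := ((m + D : ℕ) : ℝ) with hN
  have hNe : (m : ℝ) + D = N := by rw [hN]; push_cast; ring
  have hdist : dist ((η, 1 / N, m / N) : ℝ × ℝ × ℝ) (0, 0, c) < r := by
    rw [Prod.dist_eq, Prod.dist_eq, Real.dist_eq, Real.dist_eq, Real.dist_eq]
    refine max_lt ?_ (max_lt ?_ ?_)
    · rwa [sub_zero, abs_of_pos hη0]
    · rw [sub_zero, abs_of_pos (by positivity), div_lt_iff₀ hn0]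
      nlinarith
    · exact hmn.trans_lt (by linarith)
  obtain ⟨f1, f2⟩ := hball hdist
  simp only at f1 f2
  have q1 : Real.sqrt (m + D + 1 + s) = Real.sqrt N * Real.sqrt (1 + 1 / N + η) := by
    rw [← Real.sqrt_mul hn0.le, hNe, hs]
    congr 1
    field_simp
  have q2 : Real.sqrt (m + s) = Real.sqrt N * Real.sqrt (m / N + η) := by
    rw [← Real.sqrt_mul hn0.le, hs]
    congr 1
    field_simp
  have q3 : Real.sqrt N ^ 2 = N := Real.sq_sqrt hn0.le
  have q4 : N * (1 / N) = 1 := by field_simp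
  set A := Real.sqrt (1 + 1 / N + η)
  set B := Real.sqrt (m / N + η)
  have c1 : Λ₁ ≤ ((1 + Real.sqrt c + ρ) * Real.sqrt N) ^ 2 := by
    rw [hΛ₁, q1, q2, mul_pow, q3]
    have : 1 * (Real.sqrt N * A + 1 * (Real.sqrt N * B)) ^ 2 + 4 * s + 1 =
        N * ((A + B) ^ 2 + 4 * η + 1 / N) := by
      rw [hs]
      linear_combination (A + B) ^ 2 * q3 - q4
    rw [this]
    have := mul_le_mul_of_nonneg_left f1.le hn0.le
    linarith
  have c2 : 0 < (1 - Real.sqrt c - ρ) * Real.sqrt N →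
      Λ₂ ≤ -((1 - Real.sqrt c - ρ) * Real.sqrt N) ^ 2 := by
    intro hpos
    have hpos' := f2 (pos_of_mul_pos_left hpos (Real.sqrt_nonneg N))
    rw [hΛ₂, q1, q2, mul_pow, q3]
    have : -1 * (Real.sqrt N * A + -1 * (Real.sqrt N * B)) ^ 2 + 4 * s + 1 =
        -(N * ((A - B) ^ 2 - 4 * η - 1 / N)) := by
      rw [hs]
      linear_combination -(A - B) ^ 2 * q3 - q4
    rw [this]
    have := mul_le_mul_of_nonneg_left hpos'.le hn0.le
    linarith
  -- the rows
  have hrows : (cgaussMat m (m + D)).real (⋃ i : Fin m, {G | G i ∈ normDeviant (m + D) s}) ≤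
      m * T := by
    calc _ ≤ ∑ i : Fin m, (cgaussMat m (m + D)).real {G | G i ∈ normDeviant (m + D) s} :=
          measureReal_iUnion_fintype_le _
      _ ≤ ∑ _i : Fin m, T := by
          refine Finset.sum_le_sum fun i _ => ?_
          have := (measurePreserving_eval (fun _ : Fin m => cgaussVec (Fin (m + D)))
            i).measureReal_preimage (measurableSet_normDeviant (m + D) s).nullMeasurableSet
          exact (le_of_eq this).trans (hT _ le_rfl)
      _ = m * T := by simp
  have hsub : (typicalMat m (m + D) c ρ)ᶜ ⊆ ((formBounded m (m + D) 1 0 Λ₁)ᶜ ∪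
      (formBounded m (m + D) (-1) 0 Λ₂)ᶜ) ∪ ⋃ i : Fin m, {G | G i ∈ normDeviant (m + D) s} := by
    intro G hG
    by_contra hcon
    simp only [Set.mem_union, Set.mem_compl_iff, Set.mem_iUnion, Set.mem_ofPred_eq, not_or,
      not_not, not_exists, normDeviant, not_le] at hcon
    obtain ⟨⟨g1, g2⟩, g3⟩ := hcon
    refine hG ⟨singularBounds_of_formBounded (by positivity) g1 g2 c1 c2, fun i => ?_⟩
    exact (rowNorm_close (g3 i)).trans (by gcongr)
  have hfin := (measureReal_mono hsub (by finiteness)).trans (measureReal_union_le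
    (μ := cgaussMat m (m + D)) _ _)
  have hfin2 := measureReal_union_le (μ := cgaussMat m (m + D)) (formBounded m (m + D) 1 0 Λ₁)ᶜ
    (formBounded m (m + D) (-1) 0 Λ₂)ᶜ
  have hmN : (m : ℝ) ≤ N := by rw [hN]; exact_mod_cast hmle
  have hT0 : 0 ≤ T := by positivity
  have : (m : ℝ) * T ≤ N * T := by gcongr
  rw [show 10 * N * Real.exp (-(κ * N)) = 5 * (N * T) by rw [hTdef]; ring]
  linarith

/-! ### Whitening of almost uncorrelated Gaussian vectors -/

theorem trace_mul_conjTranspose_eq {ι : Type*} [Fintype ι] (A : Matrix ι ι ℂ) :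
    (A * A.conjTranspose).trace = ((∑ i, ∑ j, ‖A i j‖ ^ 2 : ℝ) : ℂ) := by
  simp only [Matrix.trace, Matrix.diag, Matrix.mul_apply, Matrix.conjTranspose_apply]
  push_cast
  refine Finset.sum_congr rfl fun i _ => Finset.sum_congr rfl fun j _ => ?_
  rw [← Complex.mul_conj']
  rfl

/-- The inverse square root `T` of a Hermitian matrix `S` close to the identity: `T S Tᴴ = 1`, and
`1 - T` is controlled by the Frobenius distance of `S` to the identity, because
`(√λ - 1)² ≤ (λ - 1)²` for each eigenvalue `λ` of `S`. -/
theorem exists_whitening_matrix {ι : Type*} [Fintype ι] [DecidableEq ι] {S : Matrix ι ι ℂ}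
    (hS : S.IsHermitian) (hδ : ∑ i, ∑ j, ‖(S - 1) i j‖ ^ 2 < 1) :
    ∃ T : Matrix ι ι ℂ, T * S * T.conjTranspose = 1 ∧
      (((1 - T) * S * (1 - T).conjTranspose).trace).re ≤ ∑ i, ∑ j, ‖(S - 1) i j‖ ^ 2 := by
  have hspec := hS.spectral_theorem
  rw [Unitary.conjStarAlgAut_apply] at hspec
  have hU2 := hS.eigenvectorUnitary.2
  have hU1 := hS.eigenvectorUnitary.2
  rw [Matrix.mem_unitaryGroup_iff] at hU2
  rw [Matrix.mem_unitaryGroup_iff'] at hU1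
  set U : Matrix ι ι ℂ := ↑hS.eigenvectorUnitary
  set l : ι → ℝ := hS.eigenvalues
  -- functional calculus in the eigenbasis
  set F : (ι → ℝ) → Matrix ι ι ℂ := fun f => U * Matrix.diagonal (fun i => (f i : ℂ)) * star U
    with hF
  have hmul : ∀ f g, F f * F g = F (f * g) := by
    intro f g
    have : F f * F g = U * Matrix.diagonal (fun i => (f i : ℂ)) * (star U * U) *
        Matrix.diagonal (fun i => (g i : ℂ)) * star U := by
      simp only [hF]
      noncomm_ring
    rw [this, hU1, mul_one, mul_assoc U, Matrix.diagonal_mul_diagonal]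
    simp [hF]
  have hone : F 1 = 1 := by simp [hF, hU2]
  have hsub : ∀ f g, F f - F g = F (f - g) := by
    intro f g
    have : Matrix.diagonal (fun i => ((f - g) i : ℂ)) =
        Matrix.diagonal (fun i => (f i : ℂ)) - Matrix.diagonal (fun i => (g i : ℂ)) := by
      rw [Matrix.diagonal_sub]
      simp
    simp only [hF]
    rw [this]
    noncomm_ring
  have hstar : ∀ f, (F f).conjTranspose = F f := by
    intro f
    simp only [hF, ← Matrix.star_eq_conjTranspose, star_mul, star_star]
    rw [Matrix.star_eq_conjTranspose (Matrix.diagonal _), Matrix.diagonal_conjTranspose, mul_assoc]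
    congr 3
    ext i
    simp
  have htr : ∀ f, (F f).trace = ((∑ i, f i : ℝ) : ℂ) := by
    intro f
    simp only [hF]
    rw [Matrix.trace_mul_comm, ← mul_assoc, hU1, one_mul, Matrix.trace_diagonal]
    push_cast
    rfl
  have hSF : S = F l := hspec
  have hfrob : ∑ i, (l i - 1) ^ 2 = ∑ i, ∑ j, ‖(S - 1) i j‖ ^ 2 := by
    have := trace_mul_conjTranspose_eq (S - 1)
    rw [hSF, ← hone, hsub, hstar, hmul, htr, ← hsub, hone, ← hSF] at this
    rw [← Complex.ofReal_inj.1 this]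
    simp [sq]
  have hpos : ∀ i, 0 < l i := by
    intro i
    have h1 : (l i - 1) ^ 2 ≤ ∑ i, (l i - 1) ^ 2 :=
      Finset.single_le_sum (f := fun i => (l i - 1) ^ 2) (fun i _ => sq_nonneg _)
        (Finset.mem_univ i)
    nlinarith
  refine ⟨F fun i => (Real.sqrt (l i))⁻¹, ?_, ?_⟩
  · rw [hstar, hSF, hmul, hmul, ← hone]
    congr 1
    ext i
    have h1 := Real.sqrt_pos.2 (hpos i)
    have h2 := Real.mul_self_sqrt (hpos i).le
    simp only [Pi.mul_apply, Pi.one_apply]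
    field_simp
    nlinarith
  · rw [← hfrob]
    rw [← hone, hsub, hstar, hSF, hmul, hmul, htr, Complex.ofReal_re]
    refine Finset.sum_le_sum fun i _ => ?_
    have h1 := Real.sqrt_pos.2 (hpos i)
    have h2 := Real.mul_self_sqrt (hpos i).le
    simp only [Pi.mul_apply, Pi.one_apply, Pi.sub_apply]
    set q := Real.sqrt (l i)
    have e : (1 - q⁻¹) * l i * (1 - q⁻¹) = (q - 1) ^ 2 := by
      rw [← h2]
      field_simp
    rw [e, ← h2]
    have : (q * q - 1) ^ 2 = (q - 1) ^ 2 * (q + 1) ^ 2 := by ring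
    rw [this]
    have h3 : 1 ≤ (q + 1) ^ 2 := by nlinarith
    nlinarith [sq_nonneg (q - 1)]

/-- A finite family of complex random variables all of whose linear combinations are centred
circular Gaussian. -/
structure IsGaussianFamily {Ω ι : Type*} [MeasurableSpace Ω] [Fintype ι] (P : Measure Ω)
    (w : ι → Ω → ℂ) : Prop where
  measurable : ∀ i, Measurable (w i)
  gaussian : ∀ a : ι → ℂ, ∃ v : ℝ≥0, IsComplexGaussian P (fun ω => ∑ i, a i * w i ω) v

/-- The matrix of second moments `E[w_i conj(w_j)]`. -/
noncomputable def covMatrix {Ω ι : Type*} [MeasurableSpace Ω] (P : Measure Ω) (w : ι → Ω → ℂ) :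
    Matrix ι ι ℂ :=
  fun i j => ∫ ω, w i ω * star (w j ω) ∂P

theorem integral_mul_star {Ω : Type*} [MeasurableSpace Ω] (P : Measure Ω) (f : Ω → ℂ) :
    ∫ ω, f ω * star (f ω) ∂P = ((∫ ω, ‖f ω‖ ^ 2 ∂P : ℝ) : ℂ) := by
  rw [← integral_complex_ofReal]
  congr 1
  ext ω
  push_cast
  exact Complex.mul_conj' (f ω)

theorem covMatrix_isHermitian {Ω ι : Type*} [MeasurableSpace Ω] (P : Measure Ω)
    (w : ι → Ω → ℂ) : (covMatrix P w).IsHermitian := by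
  ext i j
  simp only [Matrix.conjTranspose_apply, covMatrix]
  rw [← starRingEnd_apply, ← integral_conj]
  congr 1
  ext ω
  simp [mul_comm]

namespace IsGaussianFamily

variable {Ω ι : Type*} [MeasurableSpace Ω] [Fintype ι] {P : Measure Ω}
  {w : ι → Ω → ℂ}

theorem linear {κ : Type*} [Fintype κ] (hw : IsGaussianFamily P w) (T : Matrix κ ι ℂ) :
    IsGaussianFamily P (fun k ω => ∑ i, T k i * w i ω) := by
  refine ⟨fun k => ?_, fun a => ?_⟩
  · exact Finset.measurable_sum _ fun i _ => (hw.measurable i).const_mul _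
  · obtain ⟨v, hv⟩ := hw.gaussian fun i => ∑ k, a k * T k i
    refine ⟨v, ?_⟩
    convert hv using 2 with ω
    simp_rw [Finset.mul_sum, Finset.sum_mul]
    rw [Finset.sum_comm]
    exact Finset.sum_congr rfl fun i _ => Finset.sum_congr rfl fun k _ => by ring

theorem single [DecidableEq ι] (hw : IsGaussianFamily P w) (i : ι) :
    ∃ v : ℝ≥0, IsComplexGaussian P (w i) v := by
  obtain ⟨v, hv⟩ := hw.gaussian (Pi.single i 1)
  refine ⟨v, ?_⟩
  convert hv using 2 with ω
  simp [Pi.single_apply]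

variable [IsProbabilityMeasure P]

theorem memLp [DecidableEq ι] (hw : IsGaussianFamily P w) (i : ι) : MemLp (w i) 2 P := by
  obtain ⟨v, hv⟩ := hw.single i
  exact hv.memLp (hw.measurable i)

theorem integrable_mul [DecidableEq ι] (hw : IsGaussianFamily P w) (i j : ι) :
    Integrable (fun ω => w i ω * star (w j ω)) P :=
  (hw.memLp i).integrable_mul (hw.memLp j).star

theorem covMatrix_linear {κ : Type*} [DecidableEq ι] (hw : IsGaussianFamily P w)
    (T : Matrix κ ι ℂ) :
    covMatrix P (fun k ω => ∑ i, T k i * w i ω) = T * covMatrix P w * T.conjTranspose := by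
  ext k l
  simp only [covMatrix, Matrix.mul_apply, Matrix.conjTranspose_apply, Finset.sum_mul, star_sum,
    Finset.mul_sum, star_mul']
  have hterm : ∀ i j, Integrable
      (fun ω => T k j * w j ω * (star (T l i) * star (w i ω))) P := fun i j =>
    ((hw.integrable_mul j i).const_mul (T k j * star (T l i))).congr
      (Eventually.of_forall fun ω => by simp only; ring)
  rw [integral_finsetSum]
  · refine Finset.sum_congr rfl fun i _ => ?_
    rw [integral_finsetSum]
    · refine Finset.sum_congr rfl fun j _ => ?_
      rw [← integral_const_mul, ← integral_mul_const]
      congr 1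
      ext ω
      ring
    · intro j _
      exact hterm i j
  · intro i _
    exact integrable_finsetSum _ fun j _ => hterm i j

/-- A Gaussian family with identity covariance matrix has the standard Gaussian law. -/
theorem map_eq_cgaussVec [DecidableEq ι] (hw : IsGaussianFamily P w)
    (hcov : covMatrix P w = 1) :
    P.map (fun ω i => w i ω) = cgaussVec ι := by
  have hm : Measurable fun ω i => w i ω := measurable_pi_lambda _ hw.measurable
  have : IsProbabilityMeasure (P.map fun ω i => w i ω) :=
    Measure.isProbabilityMeasure_map hm.aemeasurable
  apply eq_cgaussVec
  intro a
  have hma : Measurable fun ω => ∑ i, a i * w i ω :=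
    Finset.measurable_sum _ fun i _ => (hw.measurable i).const_mul _
  obtain ⟨v, hv⟩ := hw.gaussian a
  have hvar := hv.integral_sq_norm hma
  have hcl := hw.covMatrix_linear (κ := Unit) (Matrix.of fun _ => a)
  rw [hcov, Matrix.mul_one] at hcl
  have h1 := congrFun (congrFun hcl ()) ()
  simp only [covMatrix, Matrix.mul_apply, Matrix.conjTranspose_apply, Matrix.of_apply] at h1
  rw [integral_mul_star, hvar] at h1
  have h2 : ∀ z : ℂ, z * star z = ((‖z‖ ^ 2 : ℝ) : ℂ) := by
    intro z
    push_cast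
    exact Complex.mul_conj' z
  simp_rw [h2] at h1
  rw [← Complex.ofReal_sum] at h1
  have h3 : (v : ℝ) = ∑ i, ‖a i‖ ^ 2 := Complex.ofReal_inj.1 h1
  rw [Measure.map_map (measurable_linForm a) hm]
  have := hv.charFun_map hma 1
  rw [← h3]
  change charFun (P.map fun ω => ∑ i, a i * w i ω) 1 = _
  simpa using this

/-- The whitening `z` of an almost uncorrelated Gaussian family `w`: a linear image of `w` with the
standard Gaussian law, close to `w` in `ℓ²` with overwhelming probability. -/
theorem exists_whitening [DecidableEq ι] (hw : IsGaussianFamily P w)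
    {δ : ℝ} (hδ : ∑ i, ∑ j, ‖(covMatrix P w - 1) i j‖ ^ 2 ≤ δ) (hδ1 : δ < 1) :
    ∃ T : Matrix ι ι ℂ, P.map (fun ω i => ∑ k, T i k * w k ω) = cgaussVec ι ∧
      ∀ r : ℝ, 0 ≤ r → P.real {ω | r * δ < ∑ i, ‖w i ω - ∑ k, T i k * w k ω‖ ^ 2} ≤
        Fintype.card ι * (2 * Real.exp (-(r / 2))) := by
  obtain ⟨T, hT1, hT2⟩ := exists_whitening_matrix (covMatrix_isHermitian P w)
    (hδ.trans_lt hδ1)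
  refine ⟨T, (hw.linear T).map_eq_cgaussVec ?_, fun r hr => ?_⟩
  · rw [hw.covMatrix_linear, hT1]
  have hd := hw.linear (1 - T)
  have hdw : ∀ i ω, ∑ k, (1 - T) i k * w k ω = w i ω - ∑ k, T i k * w k ω := by
    intro i ω
    simp [sub_mul, Finset.sum_sub_distrib, Matrix.one_apply]
  choose v hv using hd.single
  have hvar : ∑ i, (v i : ℝ) ≤ δ := by
    refine le_trans (le_of_eq ?_) (hT2.trans hδ)
    rw [← hw.covMatrix_linear, Matrix.trace, Complex.re_sum]
    refine Finset.sum_congr rfl fun i _ => ?_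
    rw [← (hv i).integral_sq_norm (hd.measurable i)]
    simp only [Matrix.diag, covMatrix]
    rw [integral_mul_star, Complex.ofReal_re]
  simp_rw [← hdw]
  calc _ ≤ P.real (⋃ i, {ω | r * v i < ‖∑ k, (1 - T) i k * w k ω‖ ^ 2}) := by
        refine measureReal_mono fun ω hω => ?_
        by_contra hcon
        simp only [Set.mem_iUnion, Set.mem_ofPred_eq, not_exists, not_lt] at hcon hω
        have h1 : ∑ i, ‖∑ k, (1 - T) i k * w k ω‖ ^ 2 ≤ ∑ i, r * v i :=
          Finset.sum_le_sum fun i _ => hcon i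
        rw [← Finset.mul_sum] at h1
        have h2 : r * ∑ i, (v i : ℝ) ≤ r * δ := by gcongr
        linarith
    _ ≤ ∑ i, P.real {ω | r * v i < ‖∑ k, (1 - T) i k * w k ω‖ ^ 2} :=
        measureReal_iUnion_fintype_le _
    _ ≤ ∑ _i : ι, 2 * Real.exp (-(r / 2)) :=
        Finset.sum_le_sum fun i _ => (hv i).tail (hd.measurable i) r
    _ = _ := by simp

end IsGaussianFamily

/-! ### Second moments of the Fourier coefficients -/

theorem card_filter_boundary_le (N : ℕ) (u : ℤ) :
    (((Finset.range N).filter fun j : ℕ => u + j < 0 ∨ (N : ℤ) ≤ u + j).card : ℝ) ≤ |(u : ℝ)| := by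
  have h : ((Finset.range N).filter fun j : ℕ => u + j < 0 ∨ (N : ℤ) ≤ u + j).card ≤
      u.natAbs := by
    rcases lt_or_ge u 0 with hu | hu
    · calc _ ≤ (Finset.range u.natAbs).card := by
            apply Finset.card_le_card
            intro j hj
            simp only [Finset.mem_filter, Finset.mem_range] at hj ⊢
            omega
        _ = _ := Finset.card_range _
    · calc _ ≤ (Finset.Ico (N - u.natAbs) N).card := by
            apply Finset.card_le_card
            intro j hj
            simp only [Finset.mem_filter, Finset.mem_range, Finset.mem_Ico] at hj ⊢
            omega
        _ ≤ _ := by rw [Nat.card_Ico]; omega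
  calc _ ≤ ((u.natAbs : ℕ) : ℝ) := by exact_mod_cast h
    _ = |(u : ℝ)| := by rw [Nat.cast_natAbs, Int.cast_abs]

/-- Truncation of a Toeplitz sum: replacing the inner sums by the full series costs at most
`∑ |u| ‖f u‖`, because a lag `u` is cut off for at most `|u|` indices `j`. -/
theorem norm_toeplitz_sum_sub_le {f : ℤ → ℂ} (hf : Summable fun u : ℤ => (1 + |(u : ℝ)|) * ‖f u‖)
    {θ : ℂ} (hθ : ‖θ‖ = 1) (N : ℕ) :
    ‖(∑ j ∈ Finset.range N, θ ^ j * ∑ i ∈ Finset.range N, f (i - j)) -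
      (∑ j ∈ Finset.range N, θ ^ j) * ∑' u, f u‖ ≤ ∑' u : ℤ, (1 + |(u : ℝ)|) * ‖f u‖ := by
  have hn : Summable fun u : ℤ => ‖f u‖ := by
    refine hf.of_nonneg_of_le (fun u => norm_nonneg _) fun u => ?_
    nlinarith [abs_nonneg (u : ℝ), norm_nonneg (f u)]
  -- `ind u j` says that the lag `u` is cut off at the index `j`
  let ind : ℤ → ℕ → ℝ := fun u j => if u + j < 0 ∨ (N : ℤ) ≤ u + j then 1 else 0
  have hind0 : ∀ u j, 0 ≤ ind u j := fun u j => by simp only [ind]; split_ifs <;> norm_num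
  have hind1 : ∀ u j, ind u j ≤ 1 := fun u j => by simp only [ind]; split_ifs <;> norm_num
  have hsum : ∀ j, Summable fun u => ‖f u‖ * ind u j := fun j =>
    hn.of_nonneg_of_le (fun u => mul_nonneg (norm_nonneg _) (hind0 u j)) fun u =>
      mul_le_of_le_one_right (norm_nonneg _) (hind1 u j)
  have hinner : ∀ j : ℕ, ‖(∑ i ∈ Finset.range N, f (i - j)) - ∑' u, f u‖ ≤
      ∑' u, ‖f u‖ * ind u j := by
    intro j
    have e1 : ∑ i ∈ Finset.range N, f (i - j) =
        ∑' u, f u * ((1 - ind u j : ℝ) : ℂ) := by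
      rw [tsum_eq_sum (s := (Finset.range N).image fun i : ℕ => (i : ℤ) - j)]
      · rw [Finset.sum_image (fun a _ b _ h => by simpa using h)]
        refine Finset.sum_congr rfl fun i hi => ?_
        have : ind ((i : ℤ) - j) j = 0 := by
          simp only [ind, Finset.mem_range] at hi ⊢
          rw [if_neg (by omega)]
        rw [this]
        simp
      · intro u hu
        have : ind u j = 1 := by
          simp only [ind]
          rw [if_pos]
          by_contra hcon
          apply hu
          simp only [Finset.mem_image, Finset.mem_range]
          exact ⟨(u + j).toNat, by omega, by omega⟩
        rw [this]
        simp
    have hs1 : Summable fun u => f u * ((1 - ind u j : ℝ) : ℂ) := by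
      refine Summable.of_norm_bounded hn fun u => ?_
      rw [norm_mul, Complex.norm_real, Real.norm_eq_abs]
      refine mul_le_of_le_one_right (norm_nonneg _) (abs_le.2 ⟨?_, ?_⟩) <;>
        linarith [hind0 u j, hind1 u j]
    rw [e1, ← hs1.tsum_sub hn.of_norm]
    refine tsum_of_norm_bounded (hsum j).hasSum fun u => ?_
    rw [show f u * ((1 - ind u j : ℝ) : ℂ) - f u = -(f u * ((ind u j : ℝ) : ℂ)) by push_cast; ring,
      norm_neg, norm_mul, Complex.norm_real, Real.norm_of_nonneg (hind0 u j)]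
  rw [Finset.sum_mul, ← Finset.sum_sub_distrib]
  calc _ ≤ ∑ j ∈ Finset.range N, ∑' u, ‖f u‖ * ind u j := by
        refine norm_sum_le_of_le _ fun j _ => ?_
        rw [← mul_sub, norm_mul, norm_pow, hθ, one_pow, one_mul]
        exact hinner j
    _ = ∑' u, ∑ j ∈ Finset.range N, ‖f u‖ * ind u j :=
        (Summable.tsum_finsetSum fun j _ => hsum j).symm
    _ ≤ _ := by
        refine (summable_sum fun j _ => hsum j).tsum_le_tsum (fun u => ?_) hf
        rw [← Finset.mul_sum, mul_comm]
        gcongr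
        have : ∑ j ∈ Finset.range N, ind u j ≤ |(u : ℝ)| := by
          simp only [ind]
          rw [Finset.sum_boole]
          exact card_filter_boundary_le N u
        linarith

/-- Orthogonality of the characters of the grid of mesh `1 / N`, which makes the Fourier
coefficients at distinct grid points uncorrelated to leading order. -/
theorem sum_range_rootOfUnity_pow {N : ℕ} (hN : 0 < N) {k : ℤ} (hk : |k| < N) :
    ∑ j ∈ Finset.range N, Complex.exp (2 * Complex.I * Real.pi * (k / N)) ^ j =
      if k = 0 then (N : ℂ) else 0 := by
  split_ifs with h
  · simp [h]
  · have hN' : (N : ℂ) ≠ 0 := by exact_mod_cast hN.ne'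
    have hone : Complex.exp (2 * Complex.I * Real.pi * (k / N)) ≠ 1 := by
      rw [Ne, Complex.exp_eq_one_iff]
      rintro ⟨n, hn⟩
      have hpi : (2 * Complex.I * Real.pi : ℂ) ≠ 0 := by
        simp [Real.pi_ne_zero]
      have h1 : (k : ℂ) / N = n := by
        apply mul_left_cancel₀ hpi
        rw [hn]
        ring
      rw [div_eq_iff hN'] at h1
      have h2 : k = n * N := by exact_mod_cast h1
      have h3 : (N : ℤ) ∣ k := ⟨n, by rw [h2, mul_comm]⟩
      exact h (Int.eq_zero_of_abs_lt_dvd h3 hk)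
    rw [geom_sum_eq hone, ← Complex.exp_nat_mul]
    have : (N : ℂ) * (2 * Complex.I * Real.pi * (k / N)) = k * (2 * Real.pi * Complex.I) := by
      field_simp
    rw [this, Complex.exp_int_mul_two_pi_mul_I]
    simp

/-- The coefficient of `y_{i+1}` in the normalised Fourier transform at the frequency `ν`. -/
noncomputable def fourierWeight (N : ℕ) (ν : ℝ) (i : ℕ) : ℂ :=
  1 / (Real.sqrt N : ℂ) * Complex.exp (-2 * Complex.I * Real.pi * i * ν)

theorem fourierCoeff_eq_sum {Ω : Type*} (y : ℤ → Ω → ℂ) (N : ℕ) (ν : ℝ) (ω : Ω) :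
    fourierCoeff y N ν ω = ∑ i : Fin N, fourierWeight N ν i * y ((i : ℤ) + 1) ω := by
  rw [Fin.sum_univ_eq_sum_range (fun i : ℕ => fourierWeight N ν i * y ((i : ℤ) + 1) ω)]
  unfold fourierCoeff
  have : Finset.Icc 1 N = Finset.Ico 1 (N + 1) := by ext; simp
  rw [this, Finset.sum_Ico_eq_sum_range, Finset.mul_sum]
  refine Finset.sum_congr (by simp) fun i _ => ?_
  unfold fourierWeight
  push_cast
  rw [add_sub_cancel_left, add_comm (1 : ℤ)]
  ring

section

variable {Ω : Type*} [MeasurableSpace Ω] {P : Measure Ω} {y : ℤ → Ω → ℂ}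

theorem IsStationaryGaussianSeries.isGaussianFamily (hy : IsStationaryGaussianSeries P y)
    (N : ℕ) : IsGaussianFamily P (fun (i : Fin N) => y ((i : ℤ) + 1)) := by
  refine ⟨fun i => hy.measurable _, fun a => ?_⟩
  let e : Fin N ↪ ℤ := ⟨fun i => (i : ℤ) + 1, fun i j h => by
    simp only [add_left_inj, Nat.cast_inj] at h
    exact Fin.ext h⟩
  obtain ⟨v, hv⟩ := hy.gaussian (Finset.univ.map e)
    (Function.extend e a 0)
  refine ⟨v, ?_⟩
  convert hv using 2 with ω
  rw [Finset.sum_map]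
  refine Finset.sum_congr rfl fun i _ => ?_
  rw [e.injective.extend_apply]
  rfl

theorem IsStationaryGaussianSeries.covMatrix_eq (hy : IsStationaryGaussianSeries P y) (N : ℕ)
    (i j : Fin N) :
    covMatrix P (fun (i : Fin N) => y ((i : ℤ) + 1)) i j = autocov P y ((i : ℤ) - j) := by
  have := hy.stationary ((j : ℤ) + 1) ((i : ℤ) - j)
  rw [autocov, ← this, covMatrix]
  congr 3
  ring_nf

/-- The autocovariance times the complex exponential at the frequency `ν`. -/
noncomputable def spectralTerm (P : Measure Ω) (y : ℤ → Ω → ℂ) (ν : ℝ) (u : ℤ) : ℂ :=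
  autocov P y u * Complex.exp (-2 * Complex.I * Real.pi * u * ν)

theorem norm_spectralTerm (ν : ℝ) (u : ℤ) : ‖spectralTerm P y ν u‖ = ‖autocov P y u‖ := by
  unfold spectralTerm
  rw [norm_mul, show (-2 * Complex.I * Real.pi * u * ν : ℂ) =
    ((-2 * Real.pi * u * ν : ℝ) : ℂ) * Complex.I by push_cast; ring, Complex.norm_exp_ofReal_mul_I,
    mul_one]

theorem IsStationaryGaussianSeries.integral_fourierCoeff_mul [IsProbabilityMeasure P]
    (hy : IsStationaryGaussianSeries P y)
    (N : ℕ) (ν ν' : ℝ) :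
    ∫ ω, fourierCoeff y N ν ω * star (fourierCoeff y N ν' ω) ∂P =
      1 / (N : ℂ) * ∑ j ∈ Finset.range N,
        Complex.exp (2 * Complex.I * Real.pi * ((ν' - ν : ℝ) : ℂ)) ^ j *
          ∑ i ∈ Finset.range N, spectralTerm P y ν (i - j) := by
  have h := (hy.isGaussianFamily N).covMatrix_linear (κ := Bool)
    (Matrix.of fun b i => fourierWeight N (bif b then ν else ν') i)
  have h1 := congrFun (congrFun h true) false
  simp only [covMatrix, Matrix.of_apply, cond_true, cond_false, ← fourierCoeff_eq_sum] at h1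
  rw [h1, Matrix.mul_apply, Finset.mul_sum, ← Fin.sum_univ_eq_sum_range
    (fun j => 1 / (N : ℂ) * (Complex.exp (2 * Complex.I * Real.pi * ((ν' - ν : ℝ) : ℂ)) ^ j *
          ∑ i ∈ Finset.range N, spectralTerm P y ν (i - j)))]
  refine Finset.sum_congr rfl fun j _ => ?_
  rw [Matrix.mul_apply, Finset.sum_mul, ← Fin.sum_univ_eq_sum_range
    (fun i : ℕ => spectralTerm P y ν ((i : ℤ) - ((j : ℕ) : ℤ))), Finset.mul_sum, Finset.mul_sum]
  refine Finset.sum_congr rfl fun i _ => ?_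
  rw [hy.covMatrix_eq N i j]
  simp only [Matrix.of_apply, cond_true, Matrix.conjTranspose_apply, cond_false, fourierWeight,
    spectralTerm]
  have hs : (1 : ℂ) / (Real.sqrt N : ℂ) * (1 / (Real.sqrt N : ℂ)) = 1 / N := by
    rw [div_mul_div_comm, one_mul, ← Complex.ofReal_mul, Real.mul_self_sqrt (Nat.cast_nonneg N)]
    simp
  have hstar : star ((1 : ℂ) / (Real.sqrt N : ℂ) *
      Complex.exp (-2 * Complex.I * Real.pi * (j : ℕ) * ν')) =
      1 / (Real.sqrt N : ℂ) * Complex.exp (2 * Complex.I * Real.pi * (j : ℕ) * ν') := by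
    rw [star_mul', ← starRingEnd_apply, ← starRingEnd_apply, ← Complex.exp_conj]
    have h2 : (starRingEnd ℂ) 2 = 2 := Complex.conj_ofNat 2
    simp [Complex.conj_ofReal, h2]
  rw [hstar, ← Complex.exp_nat_mul, ← hs]
  have hexp : Complex.exp (-2 * Complex.I * Real.pi * (i : ℕ) * ν) *
      Complex.exp (2 * Complex.I * Real.pi * (j : ℕ) * ν') =
      Complex.exp ((j : ℕ) * (2 * Complex.I * Real.pi * ((ν' - ν : ℝ) : ℂ))) *
      Complex.exp (-2 * Complex.I * Real.pi * (((i : ℕ) : ℤ) - ((j : ℕ) : ℤ) : ℤ) * ν) := by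
    rw [← Complex.exp_add, ← Complex.exp_add]
    congr 1
    push_cast
    ring
  linear_combination (1 / (Real.sqrt N : ℂ) * (1 / (Real.sqrt N : ℂ)) *
    autocov P y (((i : ℕ) : ℤ) - ((j : ℕ) : ℤ))) * hexp

variable {C : ℝ}

/-- The covariance of the Fourier coefficients at the grid points `ν` and `ν + k / N`: they are
uncorrelated with variance `s(ν)`, up to `O(1 / N)`. -/
theorem IsStationaryGaussianSeries.norm_covariance_sub_le [IsProbabilityMeasure P]
    (hy : IsStationaryGaussianSeries P y)
    (hs : Summable fun u : ℤ => (1 + |(u : ℝ)|) * ‖autocov P y u‖)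
    (hC : ∑' u : ℤ, (1 + |(u : ℝ)|) * ‖autocov P y u‖ ≤ C) {N : ℕ} (hN : 0 < N) (ν : ℝ) {k : ℤ}
    (hk : |k| < N) :
    ‖∫ ω, fourierCoeff y N ν ω * star (fourierCoeff y N (ν + k / N) ω) ∂P -
      if k = 0 then (spectralDensity P y ν : ℂ) else 0‖ ≤ C / N := by
  have hN' : (0 : ℝ) < N := by exact_mod_cast hN
  have hNc : (N : ℂ) ≠ 0 := by exact_mod_cast hN.ne'
  have h1 := norm_toeplitz_sum_sub_le (f := spectralTerm P y ν)
    (by simpa only [norm_spectralTerm] using hs)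
    (θ := Complex.exp (2 * Complex.I * Real.pi * (k / N))) (by
      rw [show (2 * Complex.I * Real.pi * (k / N) : ℂ) = ((2 * Real.pi * (k / N) : ℝ) : ℂ) *
        Complex.I by push_cast; ring, Complex.norm_exp_ofReal_mul_I]) N
  simp only [norm_spectralTerm] at h1
  rw [sum_range_rootOfUnity_pow hN hk] at h1
  have h2 := hy.integral_fourierCoeff_mul N ν (ν + k / N)
  rw [add_sub_cancel_left] at h2
  push_cast at h2
  set E := ∫ ω, fourierCoeff y N ν ω * star (fourierCoeff y N (ν + k / N) ω) ∂P with hE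
  have h3 : ‖E - if k = 0 then ∑' u, spectralTerm P y ν u else 0‖ ≤ C / N := by
    rw [h2]
    calc _ = ‖1 / (N : ℂ) * ((∑ j ∈ Finset.range N,
          Complex.exp (2 * Complex.I * Real.pi * (k / N)) ^ j *
            ∑ i ∈ Finset.range N, spectralTerm P y ν (i - j)) -
          (if k = 0 then (N : ℂ) else 0) * ∑' u, spectralTerm P y ν u)‖ := by
          congr 1
          rw [mul_sub]
          congr 1
          split_ifs
          · field_simp
          · simp
      _ ≤ 1 / N * C := by
          rw [norm_mul, norm_div, norm_one, Complex.norm_natCast]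
          gcongr
          exact h1.trans hC
      _ = C / N := by ring
  split_ifs with hk0
  · rw [if_pos hk0] at h3
    -- the variance is real, so that passing to the real part of the series does not hurt
    have hEre : E = ((∫ ω, ‖fourierCoeff y N ν ω‖ ^ 2 ∂P : ℝ) : ℂ) := by
      rw [hE, hk0, ← integral_mul_star]
      simp
    rw [hEre, spectralDensity, ← Complex.ofReal_sub, Complex.norm_real, Real.norm_eq_abs]
    rw [hEre] at h3
    refine le_trans ?_ h3
    refine le_trans (le_of_eq ?_) (Complex.abs_re_le_norm _)
    simp [spectralTerm]
  · rwa [if_neg hk0] at h3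

theorem summable_norm_autocov
    (hs : Summable fun u : ℤ => (1 + |(u : ℝ)|) * ‖autocov P y u‖) :
    Summable fun u : ℤ => ‖autocov P y u‖ := by
  refine hs.of_nonneg_of_le (fun u => norm_nonneg _) fun u => ?_
  nlinarith [abs_nonneg (u : ℝ), norm_nonneg (autocov P y u)]

theorem summable_spectralTerm (hs : Summable fun u : ℤ => (1 + |(u : ℝ)|) * ‖autocov P y u‖)
    (ν : ℝ) : Summable (spectralTerm P y ν) := by
  apply Summable.of_norm
  simpa only [norm_spectralTerm] using summable_norm_autocov hs

/-- The spectral density is the limit of the variances of the Fourier coefficients. -/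
theorem IsStationaryGaussianSeries.spectralDensity_nonneg [IsProbabilityMeasure P]
    (hy : IsStationaryGaussianSeries P y)
    (hs : Summable fun u : ℤ => (1 + |(u : ℝ)|) * ‖autocov P y u‖) (ν : ℝ) :
    0 ≤ spectralDensity P y ν := by
  have hlim : Tendsto (fun N : ℕ => -((∑' u : ℤ, (1 + |(u : ℝ)|) * ‖autocov P y u‖) / N)) atTop
      (𝓝 (-0)) := (tendsto_const_div_atTop_nhds_zero_nat _).neg
  rw [neg_zero] at hlim
  refine le_of_tendsto hlim ?_
  filter_upwards [eventually_gt_atTop 0] with N hN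
  have h := hy.norm_covariance_sub_le hs le_rfl hN ν (k := 0) (by simpa using hN)
  simp only [Int.cast_zero, zero_div, add_zero, if_true] at h
  rw [integral_mul_star, ← Complex.ofReal_sub, Complex.norm_real, Real.norm_eq_abs] at h
  have h1 := (abs_le.1 h).2
  have h2 : 0 ≤ ∫ ω, ‖fourierCoeff y N ν ω‖ ^ 2 ∂P := integral_nonneg fun ω => by positivity
  linarith

theorem abs_spectralDensity_sub_le
    (hs : Summable fun u : ℤ => (1 + |(u : ℝ)|) * ‖autocov P y u‖)
    (hC : ∑' u : ℤ, (1 + |(u : ℝ)|) * ‖autocov P y u‖ ≤ C) (ν ν' : ℝ) :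
    |spectralDensity P y ν - spectralDensity P y ν'| ≤ 2 * Real.pi * C * |ν - ν'| := by
  have e : spectralDensity P y ν - spectralDensity P y ν' =
      (∑' u, (spectralTerm P y ν u - spectralTerm P y ν' u)).re := by
    rw [(summable_spectralTerm hs ν).tsum_sub (summable_spectralTerm hs ν'), Complex.sub_re]
    rfl
  rw [e]
  refine (Complex.abs_re_le_norm _).trans ?_
  have hb : ∀ u, ‖spectralTerm P y ν u - spectralTerm P y ν' u‖ ≤
      2 * Real.pi * |ν - ν'| * ((1 + |(u : ℝ)|) * ‖autocov P y u‖) := by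
    intro u
    have h1 : spectralTerm P y ν u - spectralTerm P y ν' u = autocov P y u *
        (Complex.exp (Complex.I * ((-2 * Real.pi * u * ν : ℝ) : ℂ)) -
          Complex.exp (Complex.I * ((-2 * Real.pi * u * ν' : ℝ) : ℂ))) := by
      unfold spectralTerm
      rw [mul_sub]
      congr 3 <;> · push_cast; ring
    have h2 : ‖Complex.exp (Complex.I * ((-2 * Real.pi * u * ν : ℝ) : ℂ)) -
          Complex.exp (Complex.I * ((-2 * Real.pi * u * ν' : ℝ) : ℂ))‖ ≤
        2 * Real.pi * |(u : ℝ)| * |ν - ν'| := by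
      have h3 : Complex.exp (Complex.I * ((-2 * Real.pi * u * ν : ℝ) : ℂ)) -
          Complex.exp (Complex.I * ((-2 * Real.pi * u * ν' : ℝ) : ℂ)) =
          Complex.exp (((-2 * Real.pi * u * ν' : ℝ) : ℂ) * Complex.I) *
          (Complex.exp (Complex.I * ((-2 * Real.pi * u * (ν - ν') : ℝ) : ℂ)) - 1) := by
        rw [mul_sub, mul_one, ← Complex.exp_add]
        congr 2 <;> · push_cast; ring
      rw [h3, norm_mul, Complex.norm_exp_ofReal_mul_I, one_mul]
      refine Real.norm_exp_I_mul_ofReal_sub_one_le.trans (le_of_eq ?_)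
      rw [Real.norm_eq_abs, abs_mul, abs_mul, abs_mul, abs_neg, abs_two, abs_of_pos Real.pi_pos]
    rw [h1, norm_mul]
    calc _ ≤ ‖autocov P y u‖ * (2 * Real.pi * |(u : ℝ)| * |ν - ν'|) := by gcongr
      _ = 2 * Real.pi * |ν - ν'| * (|(u : ℝ)| * ‖autocov P y u‖) := by ring
      _ ≤ _ := by
        gcongr
        linarith
  refine (tsum_of_norm_bounded (hs.mul_left (2 * Real.pi * |ν - ν'|)).hasSum hb).trans ?_
  rw [tsum_mul_left]
  calc _ ≤ 2 * Real.pi * |ν - ν'| * C := by gcongr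
    _ = _ := by ring

end

/-! ### Deterministic perturbation of singular values -/

section

variable {m n : ℕ}

theorem act_sub (G H : Fin m → Fin n → ℂ) (x : EuclideanSpace ℂ (Fin m)) :
    act G x - act H x = act (G - H) x := by
  ext j
  simp [act, mul_sub, Finset.sum_sub_distrib]

theorem act_single (G : Fin m → Fin n → ℂ) (i : Fin m) :
    act G (EuclideanSpace.single i 1) = WithLp.toLp 2 (G i) := by
  ext j
  simp [act]

theorem norm_act_le_frobenius (G : Fin m → Fin n → ℂ) (x : EuclideanSpace ℂ (Fin m)) :
    ‖act G x‖ ≤ Real.sqrt (∑ i, ∑ j, ‖G i j‖ ^ 2) * ‖x‖ := by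
  rw [← sq_le_sq₀ (norm_nonneg _) (by positivity), mul_pow, Real.sq_sqrt (by positivity),
    norm_act_sq, EuclideanSpace.norm_sq_eq x, rowForm, Finset.sum_comm, Finset.sum_mul]
  refine Finset.sum_le_sum fun j _ => ?_
  calc ‖∑ i, x i * G i j‖ ^ 2 ≤ (∑ i, ‖x i‖ * ‖G i j‖) ^ 2 := by
        gcongr
        exact norm_sum_le_of_le _ fun i _ => (norm_mul _ _).le
    _ ≤ (∑ i, ‖x i‖ ^ 2) * ∑ i, ‖G i j‖ ^ 2 := Finset.sum_mul_sq_le_sq_mul_sq _ _ _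
    _ = _ := mul_comm _ _

theorem norm_smul_coord_le {d : Fin m → ℝ} {a : ℝ} (ha : 0 ≤ a) (hd : ∀ i, |d i| ≤ a)
    (x : EuclideanSpace ℂ (Fin m)) :
    ‖(WithLp.toLp 2 fun i => (d i : ℂ) * x i : EuclideanSpace ℂ (Fin m))‖ ≤ a * ‖x‖ := by
  rw [← sq_le_sq₀ (norm_nonneg _) (by positivity), mul_pow, EuclideanSpace.norm_sq_eq,
    EuclideanSpace.norm_sq_eq, Finset.mul_sum]
  refine Finset.sum_le_sum fun i _ => ?_
  simp only [norm_mul, mul_pow, Complex.norm_real, Real.norm_eq_abs]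
  gcongr
  exact hd i

theorem le_norm_smul_coord {d : Fin m → ℝ} {a : ℝ} (ha : 0 ≤ a) (hd : ∀ i, a ≤ d i)
    (x : EuclideanSpace ℂ (Fin m)) :
    a * ‖x‖ ≤ ‖(WithLp.toLp 2 fun i => (d i : ℂ) * x i : EuclideanSpace ℂ (Fin m))‖ := by
  rw [← sq_le_sq₀ (by positivity) (norm_nonneg _), mul_pow, EuclideanSpace.norm_sq_eq,
    EuclideanSpace.norm_sq_eq, Finset.mul_sum]
  refine Finset.sum_le_sum fun i _ => ?_
  simp only [norm_mul, mul_pow, Complex.norm_real, Real.norm_eq_abs]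
  gcongr
  exact (hd i).trans (le_abs_self _)

theorem norm_truncate_le (k : ℕ) (v : EuclideanSpace ℂ (Fin n)) :
    ‖(WithLp.toLp 2 fun j : Fin n => if k < (j : ℕ) then v j else 0 :
      EuclideanSpace ℂ (Fin n))‖ ≤ ‖v‖ := by
  rw [← sq_le_sq₀ (norm_nonneg _) (norm_nonneg _), EuclideanSpace.norm_sq_eq,
    EuclideanSpace.norm_sq_eq]
  refine Finset.sum_le_sum fun j _ => ?_
  simp only
  split_ifs
  · exact le_rfl
  · simp

/-- Entrywise multiplication by weights that vary slowly along the rows is a small perturbation in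
operator norm. Summation by parts along the rows writes the perturbation as a sum of products of
`G` with a diagonal matrix on the left and a coordinate projection on the right. -/
theorem norm_act_hadamard_sub_le (G : Fin m → Fin n → ℂ) {u a b : ℝ}
    (hG : ∀ x, ‖act G x‖ ≤ u * ‖x‖) (hu : 0 ≤ u) (ha : 0 ≤ a) (hb : 0 ≤ b) (h : Fin m → ℕ → ℝ)
    (h0 : ∀ i, |h i 0 - 1| ≤ a) (hstep : ∀ i k, k < n → |h i (k + 1) - h i k| ≤ b)
    (x : EuclideanSpace ℂ (Fin m)) :
    ‖act (fun i j => (h i j : ℂ) * G i j) x - act G x‖ ≤ (a + n * b) * u * ‖x‖ := by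
  let y₀ : EuclideanSpace ℂ (Fin m) := WithLp.toLp 2 fun i => ((h i 0 - 1 : ℝ) : ℂ) * x i
  let y : ℕ → EuclideanSpace ℂ (Fin m) := fun k =>
    WithLp.toLp 2 fun i => ((h i (k + 1) - h i k : ℝ) : ℂ) * x i
  have e : act (fun i j => (h i j : ℂ) * G i j) x - act G x = act G y₀ +
      ∑ k ∈ Finset.range n, (WithLp.toLp 2 fun j : Fin n => if k < (j : ℕ) then act G (y k) j
        else 0 : EuclideanSpace ℂ (Fin n)) := by
    rw [act_sub]
    ext j
    simp only [PiLp.add_apply, WithLp.ofLp_sum, Finset.sum_apply]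
    have e1 : ∑ k ∈ Finset.range n, (if k < (j : ℕ) then act G (y k) j else 0) =
        ∑ k ∈ Finset.range j, act G (y k) j := by
      rw [← Finset.sum_filter]
      refine Finset.sum_congr ?_ fun _ _ => rfl
      ext k
      simp only [Finset.mem_filter, Finset.mem_range]
      omega
    rw [e1]
    simp only [act, y, y₀, Pi.sub_apply]
    rw [Finset.sum_comm, ← Finset.sum_add_distrib]
    refine Finset.sum_congr rfl fun i _ => ?_
    rw [← Finset.sum_mul, ← Finset.sum_mul, ← Complex.ofReal_sum, Finset.sum_range_sub]
    push_cast
    ring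
  rw [e]
  have b0 : ‖act G y₀‖ ≤ u * (a * ‖x‖) :=
    (hG _).trans (by gcongr; exact norm_smul_coord_le ha h0 x)
  have bk : ‖∑ k ∈ Finset.range n, (WithLp.toLp 2 fun j : Fin n =>
      if k < (j : ℕ) then act G (y k) j else 0 : EuclideanSpace ℂ (Fin n))‖ ≤
      ∑ k ∈ Finset.range n, u * (b * ‖x‖) := by
    refine norm_sum_le_of_le _ fun k hk => ?_
    refine (norm_truncate_le k (act G (y k))).trans ((hG _).trans ?_)
    gcongr
    exact norm_smul_coord_le hb (fun i => hstep i k (Finset.mem_range.1 hk)) x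
  refine (norm_add_le _ _).trans ((add_le_add b0 bk).trans (le_of_eq ?_))
  rw [Finset.sum_const, Finset.card_range, nsmul_eq_mul]
  ring

/-- Typicality is stable under perturbations that are small in operator norm; the rows are the
images of the basis vectors. -/
theorem typicalMat_of_norm_act_sub_le {c ρ κ : ℝ} {G H : Fin m → Fin n → ℂ}
    (hG : G ∈ typicalMat m n c ρ)
    (h : ∀ x, ‖act H x - act G x‖ ≤ κ * Real.sqrt n * ‖x‖) : H ∈ typicalMat m n c (ρ + κ) := by
  refine ⟨fun x => ?_, fun i => ?_⟩
  · obtain ⟨h1, h2⟩ := hG.1 x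
    have h3 := abs_le.1 ((abs_norm_sub_norm_le (act H x) (act G x)).trans (h x))
    constructor <;> linarith [h3.1, h3.2]
  · have h1 := hG.2 i
    have h2 := (abs_norm_sub_norm_le _ _).trans (h (EuclideanSpace.single i 1))
    rw [act_single, act_single] at h2
    have h3 : ‖(EuclideanSpace.single i 1 : EuclideanSpace ℂ (Fin m))‖ = 1 := by simp
    rw [h3, mul_one] at h2
    have h4 := abs_sub_le ‖(WithLp.toLp 2 (H i) : EuclideanSpace ℂ (Fin n))‖
      ‖(WithLp.toLp 2 (G i) : EuclideanSpace ℂ (Fin n))‖ (Real.sqrt n)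
    linarith

/-- The matrix `n⁻¹ X X^*`. -/
noncomputable def gramMat (X : Fin m → Fin n → ℂ) : Matrix (Fin m) (Fin m) ℂ :=
  Matrix.of fun i j => 1 / (n : ℂ) * ∑ b, X i b * star (X j b)

/-- The eigenvalues of `n⁻¹ X X^*` are Rayleigh quotients, hence squares of numbers between the
singular value bounds of `X`, divided by `n`. A nonpositive lower bound carries no information and
is not needed, as `ε` is then larger than `(1 - √c)²`. -/
theorem spectrumLocalized_gramMat {X : Fin m → Fin n → ℂ} {c ε ρ : ℝ} (hn : 0 < n)
    (hc1 : c < 1) (hρ : 0 < ρ) (hρ1 : ρ ≤ 1) (hρε : 5 * ρ ≤ ε)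
    (hX : SingularBounds X ((1 - Real.sqrt c - ρ) * Real.sqrt n)
      ((1 + Real.sqrt c + ρ) * Real.sqrt n)) : SpectrumLocalized (gramMat X) c ε := by
  have hsc0 := Real.sqrt_nonneg c
  have hsc : Real.sqrt c < 1 := by rw [Real.sqrt_lt' one_pos]; simpa using hc1
  have hn' : (0 : ℝ) < n := by exact_mod_cast hn
  intro z hz
  rw [← Matrix.spectrum_toLin', ← Module.End.hasEigenvalue_iff_mem_spectrum] at hz
  obtain ⟨v, hv⟩ := hz.exists_hasEigenvector
  have hv0 := hv.2
  have hv1 : (gramMat X).mulVec v = z • v := by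
    simpa [Matrix.toLin'_apply] using hv.apply_eq_smul
  let x : EuclideanSpace ℂ (Fin m) := WithLp.toLp 2 fun i => star (v i)
  have hx0 : 0 < ‖x‖ := by
    rw [norm_pos_iff]
    intro h
    apply hv0
    ext i
    have := congrArg (fun w : EuclideanSpace ℂ (Fin m) => w i) h
    simpa [x] using this
  -- the Rayleigh quotient of the eigenvector
  have key : z * ((‖x‖ ^ 2 : ℝ) : ℂ) = ((‖act X x‖ ^ 2 / n : ℝ) : ℂ) := by
    have h1 : ∑ i, star (v i) * (gramMat X).mulVec v i = z * ((‖x‖ ^ 2 : ℝ) : ℂ) := by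
      rw [hv1, EuclideanSpace.norm_sq_eq]
      push_cast
      rw [Finset.mul_sum]
      refine Finset.sum_congr rfl fun i _ => ?_
      have := Complex.mul_conj' (v i)
      rw [starRingEnd_apply] at this
      simp only [Pi.smul_apply, smul_eq_mul, x, norm_star]
      rw [← this]
      ring
    have h2 : ∑ i, star (v i) * (gramMat X).mulVec v i = ((‖act X x‖ ^ 2 / n : ℝ) : ℂ) := by
      rw [norm_act_sq, rowForm]
      push_cast
      have h3 : ∀ b, ((‖∑ i, x i * X i b‖ : ℝ) : ℂ) ^ 2 =
          ∑ i, ∑ j, star (v i) * v j * (X i b * star (X j b)) := by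
        intro b
        rw [← Complex.mul_conj', starRingEnd_apply, star_sum, Finset.sum_mul_sum]
        refine Finset.sum_congr rfl fun i _ => Finset.sum_congr rfl fun j _ => ?_
        simp only [x, star_mul', star_star]
        ring
      simp_rw [h3]
      rw [Finset.sum_comm, Finset.sum_div]
      refine Finset.sum_congr rfl fun i _ => ?_
      rw [Matrix.mulVec, dotProduct, Finset.sum_comm, Finset.mul_sum, Finset.sum_div]
      refine Finset.sum_congr rfl fun j _ => ?_
      rw [← Finset.mul_sum, gramMat, Matrix.of_apply]
      ring
    rw [← h1, h2]
  have hx2 : (0 : ℝ) < ‖x‖ ^ 2 := by positivity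
  refine ⟨‖act X x‖ ^ 2 / n / ‖x‖ ^ 2, ?_, ?_⟩
  · obtain ⟨h1, h2⟩ := hX x
    have hsn : Real.sqrt n ^ 2 = n := Real.sq_sqrt hn'.le
    constructor
    · rw [le_div_iff₀ hx2, le_div_iff₀ hn']
      rcases le_or_gt 0 (1 - Real.sqrt c - ρ) with hl | hl
      · have h3 : ((1 - Real.sqrt c - ρ) * Real.sqrt n * ‖x‖) ^ 2 ≤ ‖act X x‖ ^ 2 := by gcongr
        refine le_trans ?_ h3
        rw [mul_pow, mul_pow, hsn]
        have h4 : (1 - Real.sqrt c) ^ 2 - ε ≤ (1 - Real.sqrt c - ρ) ^ 2 := by nlinarith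
        calc _ ≤ (1 - Real.sqrt c - ρ) ^ 2 * ‖x‖ ^ 2 * n := by gcongr
          _ = _ := by ring
      · have h4 : (1 - Real.sqrt c) ^ 2 - ε ≤ 0 := by nlinarith
        have h5 : ((1 - Real.sqrt c) ^ 2 - ε) * ‖x‖ ^ 2 * n ≤ 0 := by
          rw [mul_assoc]
          exact mul_nonpos_of_nonpos_of_nonneg h4 (by positivity)
        exact h5.trans (by positivity)
    · rw [div_le_iff₀ hx2, div_le_iff₀ hn']
      have h3 : ‖act X x‖ ^ 2 ≤ ((1 + Real.sqrt c + ρ) * Real.sqrt n * ‖x‖) ^ 2 := by gcongr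
      refine h3.trans ?_
      rw [mul_pow, mul_pow, hsn]
      have h4 : (1 + Real.sqrt c + ρ) ^ 2 ≤ (1 + Real.sqrt c) ^ 2 + ε := by nlinarith
      calc _ = (1 + Real.sqrt c + ρ) ^ 2 * ‖x‖ ^ 2 * n := by ring
        _ ≤ _ := by gcongr
  · rw [Complex.ofReal_div, ← key]
    have : ((‖x‖ ^ 2 : ℝ) : ℂ) ≠ 0 := by exact_mod_cast hx2.ne'
    field_simp

/-- Normalising the rows of a typical matrix to length `√n` moves its singular values little. -/
theorem singularBounds_normalizeRows {X : Fin m → Fin n → ℂ} {c ρ : ℝ} (hn : 0 < n) (hc1 : c < 1)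
    (hρ : 0 < ρ) (hρ1 : ρ ≤ 1 / 4) (hX : X ∈ typicalMat m n c ρ) :
    SingularBounds (fun i b => ((Real.sqrt n / ‖(WithLp.toLp 2 (X i) :
        EuclideanSpace ℂ (Fin n))‖ : ℝ) : ℂ) * X i b)
      ((1 - Real.sqrt c - 6 * ρ) * Real.sqrt n) ((1 + Real.sqrt c + 6 * ρ) * Real.sqrt n) := by
  have hsc0 := Real.sqrt_nonneg c
  have hsc : Real.sqrt c < 1 := by rw [Real.sqrt_lt' one_pos]; simpa using hc1
  have hsn : 0 < Real.sqrt n := Real.sqrt_pos.2 (by exact_mod_cast hn)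
  set d : Fin m → ℝ := fun i => Real.sqrt n / ‖(WithLp.toLp 2 (X i) :
        EuclideanSpace ℂ (Fin n))‖ with hd
  have hd1 : ∀ i, 1 - ρ ≤ d i ∧ d i ≤ 1 + 2 * ρ := by
    intro i
    obtain ⟨h1, h2⟩ := abs_le.1 (hX.2 i)
    set t := ‖(WithLp.toLp 2 (X i) : EuclideanSpace ℂ (Fin n))‖ with ht
    have ht0 : 0 < t := by nlinarith
    simp only [hd, ← ht]
    constructor
    · rw [le_div_iff₀ ht0]
      have : (1 - ρ) * t ≤ (1 - ρ) * ((1 + ρ) * Real.sqrt n) := by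
        gcongr
        · linarith
        · linarith
      nlinarith
    · rw [div_le_iff₀ ht0]
      have : (1 + 2 * ρ) * ((1 - ρ) * Real.sqrt n) ≤ (1 + 2 * ρ) * t := by
        gcongr
        linarith
      nlinarith [mul_nonneg hρ.le hsn.le]
  intro x
  have e : act (fun i b => (d i : ℂ) * X i b) x =
      act X (WithLp.toLp 2 fun i => (d i : ℂ) * x i) := by
    ext j
    simp only [act]
    exact Finset.sum_congr rfl fun i _ => by ring
  change _ ≤ ‖act (fun i b => (d i : ℂ) * X i b) x‖ ∧ ‖act (fun i b => (d i : ℂ) * X i b) x‖ ≤ _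
  rw [e]
  obtain ⟨h1, h2⟩ := hX.1 (WithLp.toLp 2 fun i => (d i : ℂ) * x i)
  have n1 := le_norm_smul_coord (by linarith : 0 ≤ 1 - ρ) (fun i => (hd1 i).1) x
  have n2 := norm_smul_coord_le (by linarith : 0 ≤ 1 + 2 * ρ)
    (fun i => abs_le.2 ⟨by linarith [(hd1 i).1], (hd1 i).2⟩) x
  constructor
  · rcases le_or_gt 0 (1 - Real.sqrt c - ρ) with hl | hl
    · refine le_trans ?_ h1
      calc _ ≤ ((1 - Real.sqrt c - ρ) * (1 - ρ)) * Real.sqrt n * ‖x‖ := by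
            gcongr
            nlinarith
        _ = (1 - Real.sqrt c - ρ) * Real.sqrt n * ((1 - ρ) * ‖x‖) := by ring
        _ ≤ _ := by gcongr
    · refine le_trans ?_ (norm_nonneg _)
      rw [mul_assoc]
      exact mul_nonpos_of_nonpos_of_nonneg (by linarith) (by positivity)
  · refine h2.trans ?_
    calc _ ≤ (1 + Real.sqrt c + ρ) * Real.sqrt n * ((1 + 2 * ρ) * ‖x‖) := by gcongr
      _ = ((1 + Real.sqrt c + ρ) * (1 + 2 * ρ)) * Real.sqrt n * ‖x‖ := by ring
      _ ≤ _ := by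
        gcongr
        nlinarith

end

/-! ### The normalised Fourier coefficients at a fixed sample size -/

/-- The `k`-th smoothing frequency `ν + (k - B / 2) / N`. -/
noncomputable def gridFreq (N B : ℕ) (ν : ℝ) (k : ℕ) : ℝ :=
  ν + (((k : ℤ) - ((B / 2 : ℕ) : ℤ) : ℤ) : ℝ) / N

/-- The `M × (B + 1)` matrix of the Fourier coefficients at the smoothing frequencies. -/
noncomputable def coeffMat {Ω : Type*} (y : ℕ → ℤ → Ω → ℂ) (N B M : ℕ) (ν : ℝ) (ω : Ω) :
    Fin M → Fin (B + 1) → ℂ :=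
  fun m k => fourierCoeff (y m) N (gridFreq N B ν k) ω

theorem smoothedPeriodogram_eq_gramMat {Ω : Type*} (y : ℕ → ℤ → Ω → ℂ) (N : ℕ) {B : ℕ}
    (hB : Even B) (M : ℕ) (ν : ℝ) (ω : Ω) :
    smoothedPeriodogram y N B M ν ω = gramMat (coeffMat y N B M ν ω) := by
  obtain ⟨h, rfl⟩ := hB
  have hh : (h + h) / 2 = h := by omega
  ext i j
  rw [smoothedPeriodogram, Matrix.smul_apply, Matrix.sum_apply, gramMat, Matrix.of_apply, hh]
  push_cast
  rw [smul_eq_mul]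
  congr 1
  simp only [coeffMat]
  rw [Fin.sum_univ_eq_sum_range (fun k : ℕ =>
    fourierCoeff (y i) N (gridFreq N (h + h) ν k) ω *
      star (fourierCoeff (y j) N (gridFreq N (h + h) ν k) ω))]
  refine Finset.sum_nbij' (fun b : ℤ => (b + h).toNat) (fun k : ℕ => (k : ℤ) - h) ?_ ?_ ?_ ?_ ?_
  · intro b hb
    simp only [Finset.mem_Icc, Finset.mem_range] at hb ⊢
    omega
  · intro k hk
    simp only [Finset.mem_Icc, Finset.mem_range] at hk ⊢
    omega
  · intro b hb
    simp only [Finset.mem_Icc] at hb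
    omega
  · intro k hk
    omega
  · intro b hb
    simp only [Finset.mem_Icc] at hb
    have : (((b + h).toNat : ℕ) : ℤ) - (h : ℤ) = b := by omega
    simp only [Matrix.vecMulVec_apply, Pi.star_apply, gridFreq, hh, this]

theorem normalizeBy_gramMat {m n : ℕ} (d : Fin m → ℝ) (X : Fin m → Fin n → ℂ) :
    normalizeBy d (gramMat X) =
      gramMat fun i b => (((Real.sqrt (d i))⁻¹ : ℝ) : ℂ) * X i b := by
  ext i j
  rw [normalizeBy, Matrix.mul_diagonal, Matrix.diagonal_mul]
  simp only [gramMat, Matrix.of_apply, Finset.mul_sum, Finset.sum_mul]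
  refine Finset.sum_congr rfl fun b _ => ?_
  rw [star_mul', ← starRingEnd_apply ((((Real.sqrt (d j))⁻¹ : ℝ) : ℂ)), Complex.conj_ofReal]
  ring

theorem gramMat_diag_re {m n : ℕ} (X : Fin m → Fin n → ℂ) (i : Fin m) :
    (gramMat X i i).re = ‖(WithLp.toLp 2 (X i) : EuclideanSpace ℂ (Fin n))‖ ^ 2 / n := by
  have : gramMat X i i =
      ((‖(WithLp.toLp 2 (X i) : EuclideanSpace ℂ (Fin n))‖ ^ 2 / n : ℝ) : ℂ) := by
    rw [EuclideanSpace.norm_sq_eq, gramMat, Matrix.of_apply]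
    push_cast
    rw [one_div, inv_mul_eq_div]
    congr 1
    exact Finset.sum_congr rfl fun b _ => Complex.mul_conj' _
  rw [this, Complex.ofReal_re]

/-- The Fourier coefficients divided by the square roots of the spectral densities at `ν`. -/
noncomputable def normCoeffMat {Ω : Type*} [MeasurableSpace Ω] (P : Measure Ω)
    (y : ℕ → ℤ → Ω → ℂ) (N B M : ℕ) (ν : ℝ) (ω : Ω) : Fin M → Fin (B + 1) → ℂ :=
  fun m k => (((Real.sqrt (spectralDensity P (y m) ν))⁻¹ : ℝ) : ℂ) * coeffMat y N B M ν ω m k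

/-- The eigenvalues of both estimators are localised as soon as the matrix of normalised Fourier
coefficients is typical. -/
theorem spectrumLocalized_of_typical {Ω : Type*} [MeasurableSpace Ω] {P : Measure Ω}
    {y : ℕ → ℤ → Ω → ℂ} {N B M : ℕ} (hB : Even B) {ν c ε ρ : ℝ} (hc1 : c < 1)
    (hs : ∀ m, 0 < spectralDensity P (y m) ν) (hρ : 0 < ρ) (hρ1 : ρ ≤ 1 / 6) (hρε : 30 * ρ ≤ ε)
    {ω : Ω} (h : normCoeffMat P y N B M ν ω ∈ typicalMat M (B + 1) c ρ) :
    SpectrumLocalized (tildeC P y N B M ν ω) c ε ∧ SpectrumLocalized (hatC y N B M ν ω) c ε := by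
  constructor
  · rw [tildeC, smoothedPeriodogram_eq_gramMat y N hB, normalizeBy_gramMat]
    exact spectrumLocalized_gramMat (Nat.succ_pos B) hc1 hρ (by linarith) (by linarith) h.1
  · rw [hatC, smoothedPeriodogram_eq_gramMat y N hB, normalizeBy_gramMat]
    have h6 := singularBounds_normalizeRows (Nat.succ_pos B) hc1 hρ (by linarith) h
    refine spectrumLocalized_gramMat (Nat.succ_pos B) hc1 (ρ := 6 * ρ) (by linarith)
      (by linarith) (by linarith) ?_
    convert h6 using 3 with i b
    rw [gramMat_diag_re]
    simp only [normCoeffMat]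
    rw [← mul_assoc, ← Complex.ofReal_mul]
    congr 2
    have e : (WithLp.toLp 2 (normCoeffMat P y N B M ν ω i) : EuclideanSpace ℂ (Fin (B + 1))) =
        (((Real.sqrt (spectralDensity P (y i) ν))⁻¹ : ℝ) : ℂ) •
          (WithLp.toLp 2 (coeffMat y N B M ν ω i) : EuclideanSpace ℂ (Fin (B + 1))) := by
      ext k
      simp [normCoeffMat]
    have hs' := Real.sqrt_pos.2 (hs i)
    rw [e, norm_smul, Complex.norm_real, Real.norm_of_nonneg (by positivity),
      Real.sqrt_div (sq_nonneg _), Real.sqrt_sq (norm_nonneg _)]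
    field_simp

theorem abs_gridFreq_sub_le {N B k : ℕ} (hk : k ≤ B + 1) (ν : ℝ) :
    |gridFreq N B ν k - ν| ≤ ((B : ℝ) + 1) / N := by
  rw [gridFreq, add_sub_cancel_left, abs_div, Nat.abs_cast]
  gcongr
  have h : |(k : ℤ) - ((B / 2 : ℕ) : ℤ)| ≤ (B : ℤ) + 1 := by
    rw [abs_le]
    omega
  exact_mod_cast h

theorem abs_gridFreq_succ_sub_le (N B k : ℕ) (ν : ℝ) :
    |gridFreq N B ν (k + 1) - gridFreq N B ν k| ≤ 1 / N := by
  have : gridFreq N B ν (k + 1) - gridFreq N B ν k = 1 / N := by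
    simp only [gridFreq]
    push_cast
    ring
  rw [this, abs_of_nonneg (by positivity)]

theorem gridFreq_add (N B k l : ℕ) (ν : ℝ) :
    gridFreq N B ν l = gridFreq N B ν k + (((l : ℤ) - (k : ℤ) : ℤ) : ℝ) / N := by
  simp only [gridFreq]
  push_cast
  ring

theorem abs_sqrt_div_sub_le {a b s q : ℝ} (ha : q ≤ a) (hb : q ≤ b) (hs : q ≤ s) (hq : 0 < q) :
    |Real.sqrt a / Real.sqrt s - Real.sqrt b / Real.sqrt s| ≤ |a - b| / q := by
  have hsq : 0 < Real.sqrt q := Real.sqrt_pos.2 hq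
  have la := Real.sqrt_le_sqrt ha
  have lb := Real.sqrt_le_sqrt hb
  have ls := Real.sqrt_le_sqrt hs
  have eq : Real.sqrt q * Real.sqrt q = q := Real.mul_self_sqrt hq.le
  have h1 : |Real.sqrt a - Real.sqrt b| * Real.sqrt q ≤ |a - b| := by
    have : a - b = (Real.sqrt a - Real.sqrt b) * (Real.sqrt a + Real.sqrt b) := by
      have ea := Real.mul_self_sqrt (hq.le.trans ha)
      have eb := Real.mul_self_sqrt (hq.le.trans hb)
      nlinarith
    rw [this, abs_mul, abs_of_nonneg (by linarith : 0 ≤ Real.sqrt a + Real.sqrt b)]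
    gcongr
    linarith
  rw [← sub_div, abs_div, abs_of_nonneg (Real.sqrt_nonneg s), div_le_div_iff₀ (by linarith) hq]
  calc |Real.sqrt a - Real.sqrt b| * q =
        |Real.sqrt a - Real.sqrt b| * Real.sqrt q * Real.sqrt q := by
        rw [mul_assoc, eq]
    _ ≤ _ := by gcongr

section

variable {Ω : Type*} [MeasurableSpace Ω] {P : Measure Ω} [IsProbabilityMeasure P]

/-- The Fourier coefficients of one series, normalised frequency by frequency, are almost
uncorrelated with unit variance. -/
theorem IsStationaryGaussianSeries.normalised_covariance {y : ℤ → Ω → ℂ}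
    (hy : IsStationaryGaussianSeries P y) {C q : ℝ}
    (hs : Summable fun u : ℤ => (1 + |(u : ℝ)|) * ‖autocov P y u‖)
    (hC : ∑' u : ℤ, (1 + |(u : ℝ)|) * ‖autocov P y u‖ ≤ C) (hq : 0 < q) {N B : ℕ} {ν : ℝ}
    (hsq : ∀ k ≤ B, q ≤ spectralDensity P y (gridFreq N B ν k)) (hBN : B < N) :
    let w : Fin (B + 1) → Ω → ℂ := fun k ω =>
      (((Real.sqrt (spectralDensity P y (gridFreq N B ν k)))⁻¹ : ℝ) : ℂ) *
        fourierCoeff y N (gridFreq N B ν k) ω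
    IsGaussianFamily P w ∧ ∑ i, ∑ j, ‖(covMatrix P w - 1) i j‖ ^ 2 ≤
      (((B : ℝ) + 1) * (C / q) / N) ^ 2 := by
  intro w
  have hN : 0 < N := by omega
  have hN' : (0 : ℝ) < N := by exact_mod_cast hN
  constructor
  · have := (hy.isGaussianFamily N).linear (κ := Fin (B + 1)) (Matrix.of fun k i =>
      (((Real.sqrt (spectralDensity P y (gridFreq N B ν k)))⁻¹ : ℝ) : ℂ) *
        fourierWeight N (gridFreq N B ν k) i)
    convert this using 1
    ext k ω
    simp only [w, Matrix.of_apply, fourierCoeff_eq_sum, Finset.mul_sum, mul_assoc]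
  · have hC0 : 0 ≤ C := le_trans (tsum_nonneg fun u => by positivity) hC
    have hent : ∀ i j : Fin (B + 1), ‖(covMatrix P w - 1) i j‖ ≤ C / q / N := by
      intro i j
      set si := spectralDensity P y (gridFreq N B ν i) with hsi
      set sj := spectralDensity P y (gridFreq N B ν j) with hsj
      have h1 : q ≤ si := hsq i (by omega)
      have h2 : q ≤ sj := hsq j (by omega)
      have hri : 0 < Real.sqrt si := Real.sqrt_pos.2 (by linarith)
      have hrj : 0 < Real.sqrt sj := Real.sqrt_pos.2 (by linarith)
      have hcov := hy.norm_covariance_sub_le hs hC hN (gridFreq N B ν i)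
        (k := ((j : ℕ) : ℤ) - ((i : ℕ) : ℤ)) (by rw [abs_lt]; omega)
      rw [← gridFreq_add] at hcov
      set E := ∫ ω, fourierCoeff y N (gridFreq N B ν i) ω *
        star (fourierCoeff y N (gridFreq N B ν j) ω) ∂P
      have e1 : covMatrix P w i j = (((Real.sqrt si)⁻¹ * (Real.sqrt sj)⁻¹ : ℝ) : ℂ) * E := by
        simp only [covMatrix, w]
        rw [← integral_const_mul]
        congr 1
        ext ω
        rw [star_mul', ← starRingEnd_apply ((((Real.sqrt _)⁻¹ : ℝ) : ℂ)), Complex.conj_ofReal]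
        push_cast
        ring
      have e2 : (covMatrix P w - 1) i j = (((Real.sqrt si)⁻¹ * (Real.sqrt sj)⁻¹ : ℝ) : ℂ) *
          (E - if ((j : ℕ) : ℤ) - ((i : ℕ) : ℤ) = 0 then (si : ℂ) else 0) := by
        rw [Matrix.sub_apply, e1, mul_sub]
        congr 1
        rw [Matrix.one_apply]
        by_cases hij : i = j
        · subst hij
          rw [if_pos rfl, if_pos (sub_self _), ← Complex.ofReal_mul]
          have h3 := Real.mul_self_sqrt (hq.le.trans h1)
          rw [show sj = si from rfl]
          have : (Real.sqrt si)⁻¹ * (Real.sqrt si)⁻¹ * si = 1 := by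
            rw [← mul_inv, h3]
            exact inv_mul_cancel₀ (by linarith)
          rw [this]
          simp
        · rw [if_neg hij, if_neg, mul_zero]
          intro h
          apply hij
          ext
          omega
      rw [e2, norm_mul, Complex.norm_real, Real.norm_of_nonneg (by positivity)]
      have h4 : (Real.sqrt si)⁻¹ * (Real.sqrt sj)⁻¹ ≤ q⁻¹ := by
        rw [← mul_inv]
        apply inv_anti₀ hq
        rw [← Real.mul_self_sqrt hq.le]
        gcongr
      calc _ ≤ q⁻¹ * (C / N) := by gcongr
        _ = _ := by field_simp
    calc _ ≤ ∑ _i : Fin (B + 1), ∑ _j : Fin (B + 1), (C / q / N) ^ 2 := by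
          refine Finset.sum_le_sum fun i _ => Finset.sum_le_sum fun j _ => ?_
          have := hent i j
          gcongr
      _ = _ := by
          simp
          ring

end

/-! ### Comparison with a Gaussian matrix at a fixed sample size -/

/-- At a fixed sample size, the matrix of normalised Fourier coefficients is typical unless the
Gaussian matrix obtained by whitening its rows is atypical, or some coefficient is far from its
whitened counterpart. -/
theorem measureReal_normCoeffMat_typical_compl_le {Ω : Type*} [MeasurableSpace Ω] {P : Measure Ω}
    [IsProbabilityMeasure P] {y : ℕ → ℤ → Ω → ℂ}
    (hgauss : ∀ m, IsStationaryGaussianSeries P (y m))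
    (hindep : iIndepFun (fun (m : ℕ) (ω : Ω) (n : ℤ) => y m n ω) P) {C q c ρ r W : ℝ}
    (hs : ∀ m, Summable fun u : ℤ => (1 + |(u : ℝ)|) * ‖autocov P (y m) u‖)
    (hC : ∀ m, ∑' u : ℤ, (1 + |(u : ℝ)|) * ‖autocov P (y m) u‖ ≤ C) (hq : 0 < q)
    {N B M : ℕ} {ν : ℝ} (hν : ∀ m, 2 * q ≤ spectralDensity P (y m) ν) (hBN : B < N)
    (hc1 : c < 1) (hρ : 0 < ρ) (hρ1 : ρ ≤ 1 / 4) (hr : 0 ≤ r)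
    (h1 : 2 * Real.pi * C * (((B : ℝ) + 1) / N) ≤ q)
    (h2 : ((B : ℝ) + 1) * (C / q) / N < 1)
    (h3 : 12 * Real.pi * (C / q) * (((B : ℝ) + 1) / N) ≤ ρ)
    (h4 : M * (r * (((B : ℝ) + 1) * (C / q) / N) ^ 2) ≤ ρ ^ 2 * ((B : ℝ) + 1))
    (hW : (cgaussMat M (B + 1)).real (typicalMat M (B + 1) c ρ)ᶜ ≤ W) :
    P.real {ω | normCoeffMat P y N B M ν ω ∈ typicalMat M (B + 1) c (3 * ρ)}ᶜ ≤
      W + M * (((B : ℝ) + 1) * (2 * Real.exp (-(r / 2)))) := by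
  have hN : 0 < N := by omega
  have hN' : (0 : ℝ) < N := by exact_mod_cast hN
  have hC0 : 0 ≤ C := le_trans (tsum_nonneg fun u => by positivity) (hC 0)
  have hlip : ∀ m (k : ℕ), k ≤ B + 1 →
      |spectralDensity P (y m) (gridFreq N B ν k) - spectralDensity P (y m) ν| ≤
        2 * Real.pi * C * (((B : ℝ) + 1) / N) := by
    intro m k hk
    refine (abs_spectralDensity_sub_le (hs m) (hC m) _ _).trans ?_
    gcongr
    exact abs_gridFreq_sub_le hk ν
  have hsq : ∀ m (k : ℕ), k ≤ B + 1 → q ≤ spectralDensity P (y m) (gridFreq N B ν k) := by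
    intro m k hk
    have := (abs_le.1 (hlip m k hk)).1
    linarith [hν m]
  -- whitening of each row
  let w : ℕ → Fin (B + 1) → Ω → ℂ := fun m k ω =>
      (((Real.sqrt (spectralDensity P (y m) (gridFreq N B ν k)))⁻¹ : ℝ) : ℂ) *
        fourierCoeff (y m) N (gridFreq N B ν k) ω
  have hwh : ∀ m, ∃ T : Matrix (Fin (B + 1)) (Fin (B + 1)) ℂ,
      P.map (fun ω i => ∑ k, T i k * w m k ω) = cgaussVec (Fin (B + 1)) ∧
      P.real {ω | r * (((B : ℝ) + 1) * (C / q) / N) ^ 2 <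
        ∑ i, ‖w m i ω - ∑ k, T i k * w m k ω‖ ^ 2} ≤
          ((B : ℝ) + 1) * (2 * Real.exp (-(r / 2))) := by
    intro m
    obtain ⟨g1, g2⟩ := (hgauss m).normalised_covariance (hs m) (hC m) hq (ν := ν)
      (fun k hk => hsq m k (by omega)) hBN
    obtain ⟨T, t1, t2⟩ := g1.exists_whitening g2
      (by
        have : 0 ≤ ((B : ℝ) + 1) * (C / q) / N := by positivity
        nlinarith)
    refine ⟨T, t1, ?_⟩
    have := t2 r hr
    rw [Fintype.card_fin, show ((B + 1 : ℕ) : ℝ) = (B : ℝ) + 1 by push_cast; ring] at this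
    exact this
  choose T hT1 hT2 using hwh
  let Z : Ω → Fin M → Fin (B + 1) → ℂ := fun ω m i => ∑ k, T m i k * w m k ω
  have hwm : ∀ m k, Measurable (w m k) := by
    intro m k
    simp only [w, fourierCoeff_eq_sum]
    exact (Finset.measurable_sum _ fun i _ => ((hgauss m).measurable _).const_mul _).const_mul _
  have hZm : Measurable Z := by
    refine measurable_pi_lambda _ fun m => measurable_pi_lambda _ fun i => ?_
    exact Finset.measurable_sum _ fun k _ => (hwm m k).const_mul _
  have hZlaw : P.map Z = cgaussMat M (B + 1) := by
    let φ : ∀ _ : Fin M, (ℤ → ℂ) → Fin (B + 1) → ℂ := fun m f i => ∑ k : Fin (B + 1),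
      T m i k * ((((Real.sqrt (spectralDensity P (y m) (gridFreq N B ν k)))⁻¹ : ℝ) : ℂ) *
        ∑ j : Fin N, fourierWeight N (gridFreq N B ν k) j * f ((j : ℤ) + 1))
    have hφ : ∀ m, Measurable (φ m) := by
      intro m
      refine measurable_pi_lambda _ fun i => Finset.measurable_sum _ fun k _ => ?_
      refine ((Finset.measurable_sum _ fun j _ => ?_).const_mul _).const_mul _
      exact (measurable_pi_apply _).const_mul _
    have hind := (hindep.precomp (g := fun m : Fin M => (m : ℕ)) Fin.val_injective).comp φ hφ
    have heq : ∀ m : Fin M, (φ m ∘ fun ω (n : ℤ) => y m n ω) = fun ω => Z ω m := by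
      intro m
      ext ω i
      simp only [φ, Z, w, Function.comp, fourierCoeff_eq_sum]
    simp_rw [heq] at hind
    have hZm' : ∀ m, AEMeasurable (fun ω => Z ω m) P := fun m =>
      ((measurable_pi_apply m).comp hZm).aemeasurable
    rw [iIndepFun_iff_map_fun_eq_pi_map hZm'] at hind
    rw [cgaussMat, ← show (fun m : Fin M => P.map fun ω => Z ω m) =
      fun _ => cgaussVec (Fin (B + 1)) from funext fun m => hT1 m]
    exact hind
  have hZbad : P.real (Z ⁻¹' (typicalMat M (B + 1) c ρ)ᶜ) ≤ W := by
    rw [← map_measureReal_apply hZm (measurableSet_typicalMat _ _ _ _).compl, hZlaw]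
    exact hW
  have hsub : {ω | normCoeffMat P y N B M ν ω ∈ typicalMat M (B + 1) c (3 * ρ)}ᶜ ⊆
      Z ⁻¹' (typicalMat M (B + 1) c ρ)ᶜ ∪
        ⋃ m : Fin M, {ω | r * (((B : ℝ) + 1) * (C / q) / N) ^ 2 <
          ∑ i, ‖w m i ω - ∑ k, T m i k * w m k ω‖ ^ 2} := by
    intro ω hω
    by_contra hcon
    simp only [Set.mem_union, Set.mem_preimage, Set.mem_compl_iff, not_not, Set.mem_iUnion,
      Set.mem_ofPred_eq, not_or, not_exists, not_lt] at hcon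
    obtain ⟨hZ, hrow⟩ := hcon
    apply hω
    show normCoeffMat P y N B M ν ω ∈ typicalMat M (B + 1) c (3 * ρ)
    have hcast : (((B + 1 : ℕ) : ℝ)) = (B : ℝ) + 1 := by push_cast; ring
    -- from the whitened matrix to the matrix normalised frequency by frequency
    have hw : (fun (m : Fin M) k => w m k ω) ∈ typicalMat M (B + 1) c (ρ + ρ) := by
      refine typicalMat_of_norm_act_sub_le hZ fun x => ?_
      rw [act_sub]
      refine (norm_act_le_frobenius _ x).trans ?_
      gcongr
      rw [Real.sqrt_le_left (by positivity), mul_pow, Real.sq_sqrt (by positivity), hcast]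
      refine le_trans ?_ h4
      calc _ ≤ ∑ _m : Fin M, r * (((B : ℝ) + 1) * (C / q) / N) ^ 2 :=
            Finset.sum_le_sum fun m _ => hrow m
        _ = _ := by simp
    -- from there to the normalisation by the densities at `ν`
    have hsc0 := Real.sqrt_nonneg c
    have hsc : Real.sqrt c < 1 := by rw [Real.sqrt_lt' one_pos]; simpa using hc1
    let h : Fin M → ℕ → ℝ := fun m k => Real.sqrt (spectralDensity P (y m) (gridFreq N B ν k)) /
      Real.sqrt (spectralDensity P (y m) ν)
    have hX : normCoeffMat P y N B M ν ω =
        fun (m : Fin M) (k : Fin (B + 1)) => (h m k : ℂ) * w m k ω := by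
      ext m k
      simp only [normCoeffMat, coeffMat, h, w]
      rw [← mul_assoc, ← Complex.ofReal_mul]
      congr 2
      have : 0 < Real.sqrt (spectralDensity P (y m) (gridFreq N B ν k)) :=
        Real.sqrt_pos.2 (by linarith [hsq m k (by omega)])
      field_simp
    have had := norm_act_hadamard_sub_le (fun (m : Fin M) k => w m k ω)
      (u := (1 + Real.sqrt c + (ρ + ρ)) * Real.sqrt ((B + 1 : ℕ) : ℝ))
      (a := 2 * Real.pi * C * (((B : ℝ) + 1) / N) / q) (b := 2 * Real.pi * C * (1 / N) / q)
      (fun x => (hw.1 x).2) (by positivity) (by positivity) (by positivity) h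
      (by
        intro m
        have h5 : 0 < Real.sqrt (spectralDensity P (y m) ν) :=
          Real.sqrt_pos.2 (by linarith [hν m])
        have := abs_sqrt_div_sub_le (a := spectralDensity P (y m) (gridFreq N B ν 0))
          (b := spectralDensity P (y m) ν) (s := spectralDensity P (y m) ν) (q := q)
          (hsq m 0 (by omega)) (by linarith [hν m]) (by linarith [hν m]) hq
        rw [div_self h5.ne'] at this
        refine this.trans ?_
        gcongr
        exact hlip m 0 (by omega))
      (by
        intro m k hk
        refine (abs_sqrt_div_sub_le (q := q) (hsq m (k + 1) (by omega)) (hsq m k (by omega))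
          (by linarith [hν m]) hq).trans ?_
        gcongr
        refine (abs_spectralDensity_sub_le (hs m) (hC m) _ _).trans ?_
        gcongr
        exact abs_gridFreq_succ_sub_le N B k ν)
    rw [hX, show 3 * ρ = ρ + ρ + ρ by ring]
    refine typicalMat_of_norm_act_sub_le hw fun x => (had x).trans ?_
    rw [hcast]
    calc _ = (4 * Real.pi * (C / q) * (((B : ℝ) + 1) / N)) * (1 + Real.sqrt c + (ρ + ρ)) *
          Real.sqrt ((B : ℝ) + 1) * ‖x‖ := by
          field_simp
          ring
      _ ≤ (4 * Real.pi * (C / q) * (((B : ℝ) + 1) / N)) * 3 * Real.sqrt ((B : ℝ) + 1) * ‖x‖ := by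
          gcongr
          linarith
      _ = (12 * Real.pi * (C / q) * (((B : ℝ) + 1) / N)) * Real.sqrt ((B : ℝ) + 1) * ‖x‖ := by
          ring
      _ ≤ _ := by gcongr
  calc _ ≤ _ := measureReal_mono hsub
    _ ≤ _ := measureReal_union_le _ _
    _ ≤ W + ∑ _m : Fin M, ((B : ℝ) + 1) * (2 * Real.exp (-(r / 2))) := by
        refine add_le_add hZbad ((measureReal_iUnion_fintype_le _).trans ?_)
        exact Finset.sum_le_sum fun m _ => hT2 m
    _ = _ := by simp

/-! ### Uniform constants and the asymptotic regime -/

/-- Only the first weighted moment of the autocovariances enters the argument. -/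
theorem SpectralRegularity.exists_bound {Ω : Type*} [MeasurableSpace Ω] {P : Measure Ω}
    {y : ℕ → ℤ → Ω → ℂ} {γ₀ : ℝ} (h : SpectralRegularity P y γ₀) (hγ₀ : 1 ≤ γ₀) :
    ∃ C : ℝ, ∀ m, (Summable fun u : ℤ => (1 + |(u : ℝ)|) * ‖autocov P (y m) u‖) ∧
      ∑' u : ℤ, (1 + |(u : ℝ)|) * ‖autocov P (y m) u‖ ≤ C := by
  set S := ⨆ m : ℕ, ∑' u : ℤ, ENNReal.ofReal ((1 + |(u : ℝ)|) ^ γ₀) * ‖autocov P (y m) u‖ₑ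
  have hS : S ≠ ∞ := h.sup_finite.ne
  refine ⟨S.toReal, fun m => ?_⟩
  have hle : ∑' u : ℤ, ENNReal.ofReal ((1 + |(u : ℝ)|) * ‖autocov P (y m) u‖) ≤ S := by
    refine le_trans (ENNReal.tsum_le_tsum fun u => ?_) (le_iSup (fun m : ℕ => ∑' u : ℤ,
      ENNReal.ofReal ((1 + |(u : ℝ)|) ^ γ₀) * ‖autocov P (y m) u‖ₑ) m)
    rw [ENNReal.ofReal_mul (by positivity), ofReal_norm]
    gcongr
    exact Real.self_le_rpow_of_one_le (by linarith [abs_nonneg (u : ℝ)]) hγ₀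
  have hne := ne_top_of_le_ne_top hS hle
  have hsum := ENNReal.summable_toReal hne
  have hnn : ∀ u : ℤ, 0 ≤ (1 + |(u : ℝ)|) * ‖autocov P (y m) u‖ := fun u => by positivity
  simp only [ENNReal.toReal_ofReal (hnn _)] at hsum
  refine ⟨hsum, ?_⟩
  rw [← ENNReal.ofReal_tsum_of_nonneg hnn hsum] at hle
  exact (ENNReal.ofReal_le_iff_le_toReal hS).1 hle

theorem SpectralRegularity.exists_lower_bound {Ω : Type*} [MeasurableSpace Ω] {P : Measure Ω}
    {y : ℕ → ℤ → Ω → ℂ} {γ₀ : ℝ} (h : SpectralRegularity P y γ₀) :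
    ∃ q : ℝ, 0 < q ∧ ∀ m, ∀ ν ∈ Set.Icc (0 : ℝ) 1, q ≤ |spectralDensity P (y m) ν| := by
  obtain ⟨e, he0, he⟩ := exists_between h.inf_pos
  have hle : ∀ m, ∀ ν ∈ Set.Icc (0 : ℝ) 1, e ≤ ‖spectralDensity P (y m) ν‖ₑ := by
    intro m ν hν
    exact he.le.trans ((iInf_le _ m).trans (iInf₂_le ν hν))
  have hetop : e ≠ ∞ := by
    have := hle 0 0 (by simp)
    exact ne_top_of_le_ne_top enorm_ne_top this
  refine ⟨e.toReal, ENNReal.toReal_pos he0.ne' hetop, fun m ν hν => ?_⟩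
  have := ENNReal.toReal_mono enorm_ne_top (hle m ν hν)
  simpa using this

theorem eventually_sq_mul_exp_lt {A β γ : ℝ} (hA : 0 < A) (hγ : 0 < γ) (hγβ : γ < β) (K : ℝ) :
    ∀ᶠ N : ℕ in atTop, K * (N : ℝ) ^ 2 * Real.exp (-(A * (N : ℝ) ^ β)) <
      Real.exp (-((N : ℝ) ^ γ)) := by
  have hβ : 0 < β := hγ.trans hγβ
  have t1 : Tendsto (fun N : ℕ => (N : ℝ) ^ (-(β - γ))) atTop (𝓝 0) :=
    (tendsto_rpow_neg_atTop (by linarith)).comp tendsto_natCast_atTop_atTop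
  have t2 : Tendsto (fun N : ℕ => K * (((N : ℝ) ^ β) ^ (2 / β) *
      Real.exp (-(A / 2) * (N : ℝ) ^ β))) atTop (𝓝 (K * 0)) :=
    ((tendsto_rpow_mul_exp_neg_mul_atTop_nhds_zero (2 / β) (A / 2) (by positivity)).comp
      ((tendsto_rpow_atTop hβ).comp tendsto_natCast_atTop_atTop)).const_mul K
  rw [mul_zero] at t2
  filter_upwards [t1.eventually (gt_mem_nhds (half_pos hA)),
    t2.eventually (gt_mem_nhds one_pos), eventually_gt_atTop 0] with N h1 h2 hN
  have hN' : (0 : ℝ) < N := by exact_mod_cast hN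
  rw [← Real.rpow_mul hN'.le, mul_div_cancel₀ _ hβ.ne', Real.rpow_two] at h2
  have h3 : (N : ℝ) ^ γ ≤ A / 2 * (N : ℝ) ^ β := by
    have : (N : ℝ) ^ γ = (N : ℝ) ^ (-(β - γ)) * (N : ℝ) ^ β := by
      rw [← Real.rpow_add hN']
      congr 1
      ring
    rw [this]
    gcongr
  have hexp : Real.exp (-(A * (N : ℝ) ^ β)) =
      Real.exp (-(A / 2) * (N : ℝ) ^ β) * Real.exp (-(A / 2 * (N : ℝ) ^ β)) := by
    rw [← Real.exp_add]
    congr 1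
    ring
  calc K * (N : ℝ) ^ 2 * Real.exp (-(A * (N : ℝ) ^ β)) =
        K * ((N : ℝ) ^ 2 * Real.exp (-(A / 2) * (N : ℝ) ^ β)) *
          Real.exp (-(A / 2 * (N : ℝ) ^ β)) := by
        rw [hexp]
        ring
    _ < 1 * Real.exp (-(A / 2 * (N : ℝ) ^ β)) := by gcongr
    _ ≤ _ := by
        rw [one_mul]
        gcongr

/-- With exponentially high probability, uniformly in the frequency, the matrix of normalised
Fourier coefficients is typical. -/
theorem exists_measureReal_normCoeffMat_typical_compl_lt {Ω : Type*} [MeasurableSpace Ω]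
    {P : Measure Ω} [IsProbabilityMeasure P] {y : ℕ → ℤ → Ω → ℂ} {B M : ℕ → ℕ} {α c C q ρ : ℝ}
    (hgauss : ∀ m, IsStationaryGaussianSeries P (y m))
    (hindep : iIndepFun (fun (m : ℕ) (ω : Ω) (n : ℤ) => y m n ω) P)
    (hrate : GrowthRegime B M α c)
    (hs : ∀ m, Summable fun u : ℤ => (1 + |(u : ℝ)|) * ‖autocov P (y m) u‖)
    (hC : ∀ m, ∑' u : ℤ, (1 + |(u : ℝ)|) * ‖autocov P (y m) u‖ ≤ C) (hq : 0 < q)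
    (hlow : ∀ m, ∀ ν ∈ Set.Icc (0 : ℝ) 1, 2 * q ≤ spectralDensity P (y m) ν)
    (hρ : 0 < ρ) (hρ1 : ρ ≤ 1 / 4) :
    ∃ γ : ℝ, 0 < γ ∧ ∀ᶠ N : ℕ in atTop, ∀ ν ∈ Set.Icc (0 : ℝ) 1,
      P.real {ω | normCoeffMat P y N (B N) (M N) ν ω ∈ typicalMat (M N) (B N + 1) c (3 * ρ)}ᶜ <
        Real.exp (-((N : ℝ) ^ γ)) := by
  have hC0 : 0 ≤ C := le_trans (tsum_nonneg fun u => by positivity) (hC 0)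
  obtain ⟨κ, hκ, hW⟩ := cgaussMat_typical hrate.c_pos hrate.c_lt_one hρ
  obtain ⟨δ, hδ, hgrow⟩ := hrate.B_growth
  obtain ⟨K₁, hK₁, hB₁⟩ := hrate.B_isBigO.exists_pos
  obtain ⟨K₂, hK₂, hB₂⟩ := hgrow.exists_pos
  have hα0 : 0 < α := by linarith [hrate.half_lt]
  have hα1 : 0 < 1 - α := by linarith [hrate.lt_one]
  set K := K₁ + 1
  -- `(B + 1) / N` is at most `K t` with `t = N ^ (-(1 - α))`
  have ht : Tendsto (fun N : ℕ => (N : ℝ) ^ (-(1 - α))) atTop (𝓝 0) :=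
    (tendsto_rpow_neg_atTop hα1).comp tendsto_natCast_atTop_atTop
  have hsmall : ∀ (k : ℝ) {e : ℝ}, 0 < e → ∀ᶠ N : ℕ in atTop, k * (N : ℝ) ^ (-(1 - α)) < e := by
    intro k e he
    have := ht.const_mul k
    rw [mul_zero] at this
    exact this.eventually (gt_mem_nhds he)
  have hδtop : Tendsto (fun N : ℕ => (N : ℝ) ^ δ) atTop atTop :=
    (tendsto_rpow_atTop hδ).comp tendsto_natCast_atTop_atTop
  set γ := min δ (1 - α) / 2 with hγ
  have hγ0 : 0 < γ := by positivity
  have hγδ : γ < δ := by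
    have := min_le_left δ (1 - α)
    have h0 : 0 < min δ (1 - α) := by positivity
    rw [hγ]
    linarith
  have hγα : γ < 1 - α := by
    have := min_le_right δ (1 - α)
    have h0 : 0 < min δ (1 - α) := by positivity
    rw [hγ]
    linarith
  refine ⟨γ, hγ0, ?_⟩
  -- up to powers of `N`, the two failure probabilities are of order `exp (-κ B)`, where `B` is at
  -- least of order `N ^ δ`, and `exp (-N ^ (1 - α) / 2)`
  have hratio := hrate.ratio_tendsto
  filter_upwards [hB₁.bound, hB₂.bound, hsmall K one_pos, hsmall (2 * Real.pi * C * K) hq,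
    hsmall (K * (C / q)) one_pos, hsmall (12 * Real.pi * (C / q) * K) hρ,
    hsmall (K ^ 2 * (C / q) ^ 2) (by positivity : 0 < ρ ^ 2),
    hδtop.eventually_ge_atTop (K₂ / κ), hratio.eventually (gt_mem_nhds hrate.c_lt_one),
    hratio.eventually (Metric.closedBall_mem_nhds c hκ), eventually_gt_atTop 0,
    eventually_sq_mul_exp_lt (A := κ / K₂) (by positivity) hγ0 hγδ 20,
    eventually_sq_mul_exp_lt (A := 1 / 2) (by positivity) hγ0 hγα 4] with N e1 e2 e3 e4 e5 e6 e7 e8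
    e9 e10 hN e12 e13
  intro ν hν
  have hN' : (0 : ℝ) < N := by exact_mod_cast hN
  have hN1 : (1 : ℝ) ≤ N := by exact_mod_cast hN
  set t := (N : ℝ) ^ (-(1 - α)) with htdef
  have ht0 : 0 < t := Real.rpow_pos_of_pos hN' _
  rw [Real.norm_of_nonneg (by positivity), Real.norm_of_nonneg (by positivity)] at e1 e2
  have hBK : ((B N : ℝ) + 1) / N ≤ K * t := by
    rw [div_le_iff₀ hN']
    have h1 : t * N = (N : ℝ) ^ α := by
      rw [htdef]
      nth_rewrite 2 [← Real.rpow_one (N : ℝ)]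
      rw [← Real.rpow_add hN']
      congr 1
      ring
    have h2 : (1 : ℝ) ≤ (N : ℝ) ^ α := Real.one_le_rpow hN1 hα0.le
    rw [mul_assoc, h1]
    simp only [K]
    linarith
  have hBN1 : (B N : ℝ) + 1 < N := by
    have := hBK.trans_lt e3
    rwa [div_lt_one hN'] at this
  have hBN : B N < N := by
    have : (B N : ℝ) < N := by linarith
    exact_mod_cast this
  have hMB : (M N : ℝ) ≤ (B N : ℝ) + 1 := by
    rw [div_lt_one (by positivity)] at e9
    exact e9.le
  have hcast : ((B N + 1 : ℕ) : ℝ) = (B N : ℝ) + 1 := by push_cast; ring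
  have hgr : (N : ℝ) ^ δ / K₂ ≤ (B N : ℝ) + 1 := by
    rw [div_le_iff₀ hK₂]
    nlinarith
  have hWN := hW (M N) (B N + 1)
    (by
      rw [hcast]
      have : K₂ / κ / K₂ ≤ (B N : ℝ) + 1 := le_trans (by gcongr) hgr
      rw [div_div_cancel_left' hK₂.ne'] at this
      calc (1 : ℝ) = κ * κ⁻¹ := (mul_inv_cancel₀ hκ.ne').symm
        _ ≤ _ := by gcongr)
    (by
      rw [hcast]
      exact e10)
  rw [hcast] at hWN
  -- the deviation level `r = N ^ (1 - α)`: as `r t = 1`, the squared Frobenius norm `M r (B / N)²`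
  -- of the whitening error is still `o(B)`
  set r := (N : ℝ) ^ (1 - α) with hr
  have hr0 : 0 < r := Real.rpow_pos_of_pos hN' _
  have hrt : r * t = 1 := by
    rw [hr, htdef, ← Real.rpow_add hN']
    simp
  have main := measureReal_normCoeffMat_typical_compl_le hgauss hindep (r := r) hs hC hq
    (fun m => hlow m ν hν) hBN hrate.c_lt_one hρ hρ1 hr0.le
    (by
      calc _ ≤ 2 * Real.pi * C * (K * t) := by gcongr
        _ = 2 * Real.pi * C * K * t := by ring
        _ ≤ _ := e4.le)
    (by
      calc ((B N : ℝ) + 1) * (C / q) / N = (((B N : ℝ) + 1) / N) * (C / q) := by ring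
        _ ≤ K * t * (C / q) := by gcongr
        _ = K * (C / q) * t := by ring
        _ < 1 := e5)
    (by
      calc _ ≤ 12 * Real.pi * (C / q) * (K * t) := by gcongr
        _ = 12 * Real.pi * (C / q) * K * t := by ring
        _ ≤ _ := e6.le)
    (by
      calc _ = M N * (r * ((((B N : ℝ) + 1) / N) ^ 2 * (C / q) ^ 2)) := by ring
        _ ≤ ((B N : ℝ) + 1) * (r * ((K * t) ^ 2 * (C / q) ^ 2)) := by gcongr
        _ = (K ^ 2 * (C / q) ^ 2 * t * (r * t)) * ((B N : ℝ) + 1) := by ring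
        _ ≤ ρ ^ 2 * ((B N : ℝ) + 1) := by
          rw [hrt, mul_one]
          gcongr)
    hWN
  refine main.trans_lt ?_
  have hB2 : (B N : ℝ) + 1 ≤ (N : ℝ) ^ 2 := by nlinarith
  have f1 : 10 * ((B N : ℝ) + 1) * Real.exp (-(κ * ((B N : ℝ) + 1))) ≤
      10 * (N : ℝ) ^ 2 * Real.exp (-(κ / K₂ * (N : ℝ) ^ δ)) := by
    have hexp : κ / K₂ * (N : ℝ) ^ δ ≤ κ * ((B N : ℝ) + 1) :=
      calc κ / K₂ * (N : ℝ) ^ δ = κ * ((N : ℝ) ^ δ / K₂) := by ring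
        _ ≤ _ := by gcongr
    exact mul_le_mul (by linarith) (Real.exp_le_exp.2 (by linarith)) (Real.exp_pos _).le
      (by positivity)
  have f2 : (M N : ℝ) * (((B N : ℝ) + 1) * (2 * Real.exp (-(r / 2)))) ≤
      2 * (N : ℝ) ^ 2 * Real.exp (-(1 / 2 * r)) := by
    have : (M N : ℝ) * ((B N : ℝ) + 1) ≤ N * N :=
      mul_le_mul (by linarith) hBN1.le (by positivity) hN'.le
    calc _ = ((M N : ℝ) * ((B N : ℝ) + 1)) * (2 * Real.exp (-(1 / 2 * r))) := by ring_nf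
      _ ≤ (N * N) * (2 * Real.exp (-(1 / 2 * r))) := by gcongr
      _ = _ := by ring
  linarith

end Coherency

theorem mainTheorem5 {Ω : Type*} [MeasurableSpace Ω] (P : Measure Ω) [IsProbabilityMeasure P]
    (y : ℕ → ℤ → Ω → ℂ) (B M : ℕ → ℕ) (α c γ₀ : ℝ)
    (hgauss : ∀ m, Coherency.IsStationaryGaussianSeries P (y m))
    (hindep : iIndepFun (fun (m : ℕ) (ω : Ω) (n : ℤ) => y m n ω) P)
    (hrate : Coherency.GrowthRegime B M α c)
    (hγ₀ : 3 ≤ γ₀)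
    (hreg : Coherency.SpectralRegularity P y γ₀)
    (ε : ℝ) (hε : 0 < ε) :
    Coherency.HoldsWithExpHighProb P (U := fun _ => Set.Icc (0 : ℝ) 1)
      (fun N ν => {ω | Coherency.SpectrumLocalized
        (Coherency.tildeC P y N (B N) (M N) ν ω) c ε}) ∧
    Coherency.HoldsWithExpHighProb P (U := fun _ => Set.Icc (0 : ℝ) 1)
      (fun N ν => {ω | Coherency.SpectrumLocalized
        (Coherency.hatC y N (B N) (M N) ν ω) c ε}) := by
  obtain ⟨C, hC⟩ := hreg.exists_bound (by linarith)
  obtain ⟨q, hq, hlow⟩ := hreg.exists_lower_bound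
  have hlow' : ∀ m, ∀ ν ∈ Set.Icc (0 : ℝ) 1,
      2 * (q / 2) ≤ Coherency.spectralDensity P (y m) ν := by
    intro m ν hν
    have h1 := hlow m ν hν
    rw [abs_of_nonneg ((hgauss m).spectralDensity_nonneg (hC m).1 ν)] at h1
    linarith
  -- typicality at the level `3 ρ` requires `3 ρ ≤ 1 / 6` and `30 (3 ρ) ≤ ε`
  set ρ := min (1 / 18) (ε / 90) with hρ
  have hρ0 : 0 < ρ := by positivity
  have hρ1 : ρ ≤ 1 / 18 := min_le_left _ _
  have hρ2 : ρ ≤ ε / 90 := min_le_right _ _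
  obtain ⟨γ, hγ, hev⟩ := Coherency.exists_measureReal_normCoeffMat_typical_compl_lt hgauss hindep
    hrate (fun m => (hC m).1) (fun m => (hC m).2) (half_pos hq) hlow' hρ0 (by linarith)
  obtain ⟨N₀, hN₀⟩ := eventually_atTop.1 hev
  -- the target events need not be measurable, but a set that contains the typical event has a
  -- complement of small outer measure
  have key : ∀ N, N₀ ≤ N → ∀ (ν : Set.Icc (0 : ℝ) 1) (S : Set Ω),
      {ω | Coherency.normCoeffMat P y N (B N) (M N) ν ω ∈
        Coherency.typicalMat (M N) (B N + 1) c (3 * ρ)} ⊆ S →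
      1 - Real.exp (-((N : ℝ) ^ γ)) < P.real S := by
    intro N hN ν S hS
    have h1 := hN₀ N hN ν ν.2
    have h2 : P.real Sᶜ < Real.exp (-((N : ℝ) ^ γ)) :=
      (measureReal_mono (Set.compl_subset_compl.2 hS)).trans_lt h1
    have h3 := measureReal_union_le (μ := P) S Sᶜ
    rw [Set.union_compl_self, probReal_univ] at h3
    linarith
  have hloc : ∀ N (ν : Set.Icc (0 : ℝ) 1) (ω : Ω),
      Coherency.normCoeffMat P y N (B N) (M N) ν ω ∈
        Coherency.typicalMat (M N) (B N + 1) c (3 * ρ) →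
      Coherency.SpectrumLocalized (Coherency.tildeC P y N (B N) (M N) ν ω) c ε ∧
        Coherency.SpectrumLocalized (Coherency.hatC y N (B N) (M N) ν ω) c ε := fun N ν ω h =>
    Coherency.spectrumLocalized_of_typical (hrate.even_B N) hrate.c_lt_one
      (fun m => by linarith [hlow' m ν ν.2]) (by linarith) (by linarith) (by linarith) h
  exact ⟨⟨N₀, γ, hγ, fun N hN ν => key N hN ν _ fun ω hω => (hloc N ν ω hω).1⟩,
    ⟨N₀, γ, hγ, fun N hN ν => key N hN ν _ fun ω hω => (hloc N ν ω hω).2⟩⟩
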